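/- Let $W$ be a binary memoryless symmetric (BMS) channel with finite output alphabet $\mathcal Y$: transition probabilities $W(y\mid x)$, $x\in\{0,1\}$, $y\in\mathcal Y$, such that some permutation $\pi$ of $\mathcal Y$ with $\pi^{-1}=\pi$ satisfies $W(y\mid 1)=W(\pi(y)\mid 0)$ for all $y$. For $m\ge 0$ and $A\subseteq[m]=\{1,\dots,m\}$ let $v_m(A)\in\mathbb F_2^{\{0,1\}^m}$ be the vector $v_m(A)_z=\prod_{i\in A}z_i$. For $-1\le r\le m$ the Reed–Muller code $\mathcal R(m,r)$ is the linear span over $\mathbb F_2$ of the vectors $v_m(A)$ with $|A|\le r$ (so $\mathcal R(m,-1)=\{0\}$); its rate is its dimension divided by $2^m$. Order the subsets of $[m]$ totally as follows: $A<B$ if $|A|>|B|$, or if $|A|=|B|$ and, when the elements of $A$ and $B$ are listed in decreasing order, $A$ has the smaller element at the first place where the two lists differ. Let $(U_A)_{A\subseteq[m]}$ be i.i.d. uniform bits, let $X=\sum_{A\subseteq[m]}U_A\,v_m(A)$, and let $Y=(Y_z)_{z\in\{0,1\}^m}$ be the output when the $2^m$ coordinates of $X$ are sent through independent copies of $W$.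 Put $H_A^{(m)}=H(U_A\mid Y,(U_B)_{B<A})$ (conditional entropy in bits), and for $0\le i\le m$ $$H_{i,\max}^{(m)}=H^{(m)}_{\{1,\dots,i\}},\qquad H_{i,\min}^{(m)}=H^{(m)}_{\{m-i+1,\dots,m\}},$$ where both sets are empty for $i=0$. Reed–Muller codes are said to achieve the capacity of $W$ if there are integers $-1\le r_m\le m$ such that, as $m\to\infty$, the rate of $\mathcal R(m,r_m)$ tends to the capacity of $W$ (the maximum over input distributions of the mutual information in bits between input and output), and, for suitable decoders, the probability of incorrectly decoding a uniformly random codeword of $\mathcal R(m,r_m)$ sent through $W$ tends to $0$. 1. Suppose there are a real constant $\gamma<1$ and a function $\Delta$ with non-negative integer values such that $\Delta(m)=o(\sqrt m)$ as $m\to\infty$ and $$H_{i,\max}^{(m)}\le H_{i+\Delta(m),\min}^{(m)}+\gamma\qquad\text{for all } m>0 \text{ and all } 0\le i\le m-\Delta(m).$$ Then Reed–Muller codes achieve the capacity of $W$. 2. (Gap property.) In particular, if $H_{i,\max}^{(m)}\le H_{i+1,\min}^{(m)}$ for all $m>0$ and all $0\le i\le m-1$, then Reed–Muller codes achieve the capacity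 of $W$. -/

import Mathlib

open scoped Topology
open Filter Asymptotics

namespace RMPolar

/-! ### Probability on a finite sample space -/

open Classical in
/-- Probability of the event `E` under the mass function `P` on a finite sample space. -/
noncomputable def prob {Ω : Type*} [Fintype Ω] (P : Ω → ℝ) (E : Set Ω) : ℝ :=
  ∑ ω, if ω ∈ E then P ω else 0

/-- Conditional entropy in bits, `H(X | Z) = - ∑ P(X = s, Z = t) log₂ P(X = s | Z = t)`
(terms with `P(X = s, Z = t) = 0` vanish). -/
noncomputable def condEntropy {Ω S T : Type*} [Fintype Ω] [Fintype S] [Fintype T]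
    (P : Ω → ℝ) (X : Ω → S) (Z : Ω → T) : ℝ :=
  -∑ s, ∑ t, prob P {ω | X ω = s ∧ Z ω = t} *
    Real.logb 2 (prob P {ω | X ω = s ∧ Z ω = t} / prob P {ω | Z ω = t})

/-! ### Binary memoryless symmetric channels -/

/-- A binary memoryless symmetric (BMS) channel with finite output alphabet `𝒴`. `W.trans x y` is
the probability `W(y | x)` of receiving `y` when the bit `x` is sent. -/
structure BMSChannel (𝒴 : Type*) [Fintype 𝒴] where
  trans : ZMod 2 → 𝒴 → ℝ
  nonneg : ∀ x y, 0 ≤ trans x y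
  sum_eq_one : ∀ x, ∑ y, trans x y = 1
  symmetric : ∃ π : Equiv.Perm 𝒴, (∀ y, π (π y) = y) ∧ ∀ y, trans 1 y = trans 0 (π y)

namespace BMSChannel

variable {𝒴 : Type*} [Fintype 𝒴]

/-- Mutual information (in bits) between the input and the output of `W` when the input has the
distribution `p`. -/
noncomputable def mutualInfo (W : BMSChannel 𝒴) (p : ZMod 2 → ℝ) : ℝ :=
  ∑ x, ∑ y, p x * W.trans x y *
    Real.logb 2 (W.trans x y / ∑ x', p x' * W.trans x' y)

/-- Channel capacity: the largest mutual information over all input distributions. -/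
noncomputable def capacity (W : BMSChannel 𝒴) : ℝ :=
  sSup (W.mutualInfo '' stdSimplex ℝ (ZMod 2))

/-- Probability that the word `y` is received when the word `x` is sent through independent copies
of `W`, one for each position in `ι`. -/
noncomputable def wordProb (W : BMSChannel 𝒴) {ι : Type*} [Fintype ι]
    (x : ι → ZMod 2) (y : ι → 𝒴) : ℝ :=
  ∏ i, W.trans (x i) (y i)

end BMSChannel

/-! ### Reed-Muller codes

The ground set `{1, …, m}` is represented by `Fin m`, the element `k` being written `k - 1`. -/

/-- Points of `{0,1}^m`, which index the positions of words of length `2 ^ m`. -/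
abbrev Cube (m : ℕ) : Type := Fin m → ZMod 2

/-- The evaluation vector of the monomial `∏ i ∈ A, Z_i`. -/
def evalVec {m : ℕ} (A : Finset (Fin m)) : Cube m → ZMod 2 :=
  fun z => ∏ i ∈ A, z i

/-- The Reed-Muller code of order `r` and length `2 ^ m`, that is, the set of all linear
combinations over `𝔽₂` of the vectors `evalVec A` with `|A| ≤ r`. It is the zero code for
`r = -1`. -/
def reedMuller (m : ℕ) (r : ℤ) : Submodule (ZMod 2) (Cube m → ZMod 2) :=
  Submodule.span (ZMod 2) (evalVec '' {A : Finset (Fin m) | (A.card : ℤ) ≤ r})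

/-- The rate (dimension divided by length) of a linear code of length `2 ^ m`. -/
noncomputable def rate {m : ℕ} (C : Submodule (ZMod 2) (Cube m → ZMod 2)) : ℝ :=
  (Module.finrank (ZMod 2) C : ℝ) / 2 ^ m

open Classical in
/-- The probability that the decoder `dec` does not recover a uniformly distributed codeword of `C`
from the output of the channel. -/
noncomputable def errorProb {𝒴 : Type*} [Fintype 𝒴] (W : BMSChannel 𝒴) {m : ℕ}
    (C : Submodule (ZMod 2) (Cube m → ZMod 2))
    (dec : (Cube m → 𝒴) → (Cube m → ZMod 2)) : ℝ :=
  (∑ c : C, ∑ y : Cube m → 𝒴,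
    if dec y = (c : Cube m → ZMod 2) then 0 else W.wordProb (c : Cube m → ZMod 2) y)
      / (Nat.card C : ℝ)

/-- Reed-Muller codes achieve the capacity of `W`: for a suitable choice of orders and decoders the
rate tends to the capacity and the decoding error tends to zero. The order `-1` (the zero code) is
allowed; it can be used infinitely often only when the capacity is zero. -/
def RMAchievesCapacity {𝒴 : Type*} [Fintype 𝒴] (W : BMSChannel 𝒴) : Prop :=
  ∃ r : ℕ → ℤ, (∀ m, -1 ≤ r m ∧ r m ≤ m) ∧
    ∃ dec : (m : ℕ) → (Cube m → 𝒴) → (Cube m → ZMod 2),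
      Tendsto (fun m => rate (reedMuller m (r m))) atTop (𝓝 W.capacity) ∧
      Tendsto (fun m => errorProb W (reedMuller m (r m)) (dec m)) atTop (𝓝 0)

/-! ### Conditional entropies in the Reed-Muller ordering -/

/-- The total order on subsets of `{1, …, m}`: larger sets come first, and sets of the same
size are compared lexicographically after listing their elements in decreasing order. For sets of
the same size this is the colexicographic order. -/
def RMLt {m : ℕ} (A B : Finset (Fin m)) : Prop :=
  B.card < A.card ∨ (A.card = B.card ∧ toColex A < toColex B)

/-- The word `X = ∑ A, U_A • evalVec A`. -/
def encode {m : ℕ} (u : Finset (Fin m) → ZMod 2) : Cube m → ZMod 2 :=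
  ∑ A : Finset (Fin m), u A • evalVec A

/-- Sample space of the pair `(U, Y)`: the bits `U_A` for `A ⊆ {1, …, m}`, and the outputs of the
`2 ^ m` copies of the channel. -/
abbrev Sample (m : ℕ) (𝒴 : Type*) : Type _ :=
  (Finset (Fin m) → ZMod 2) × (Cube m → 𝒴)

/-- The law of `(U, Y)`: the `2 ^ m` bits `U_A` are independent and uniform, and `Y` is the output
of the channel on the input word `encode U`. -/
noncomputable def law {𝒴 : Type*} [Fintype 𝒴] (W : BMSChannel 𝒴) (m : ℕ) :
    Sample m 𝒴 → ℝ :=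
  fun ω => (1 / 2 : ℝ) ^ (2 ^ m) * W.wordProb (encode ω.1) ω.2

open Classical in
/-- `H_A = H(U_A | Y, U_B for all B < A)`. -/
noncomputable def H {𝒴 : Type*} [Fintype 𝒴] (W : BMSChannel 𝒴) (m : ℕ)
    (A : Finset (Fin m)) : ℝ :=
  condEntropy (law W m) (fun ω => ω.1 A)
    (fun ω => (ω.2, fun B : {B : Finset (Fin m) // RMLt B A} => ω.1 B))

/-- The set `{1, …, i}` of the `i` smallest elements of `{1, …, m}`, for `i ≤ m`. -/
def firstSet (m i : ℕ) : Finset (Fin m) := Finset.univ.filter fun k => (k : ℕ) < i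

/-- The set `{m - i + 1, …, m}` of the `i` largest elements of `{1, …, m}`, for `i ≤ m`. -/
def lastSet (m i : ℕ) : Finset (Fin m) := Finset.univ.filter fun k => m ≤ (k : ℕ) + i

/-- `H_{i,max}`, the conditional entropy at the set `{1, …, i}`. -/
noncomputable def Hmax {𝒴 : Type*} [Fintype 𝒴] (W : BMSChannel 𝒴) (m i : ℕ) : ℝ :=
  H W m (firstSet m i)

/-- `H_{i,min}`, the conditional entropy at the set `{m - i + 1, …, m}`. -/
noncomputable def Hmin {𝒴 : Type*} [Fintype 𝒴] (W : BMSChannel 𝒴) (m i : ℕ) : ℝ :=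
  H W m (lastSet m i)

end RMPolar

namespace RMPolar

/-! ### Information measures on a finite sample space -/

section Info

variable {Ω Ω' S T T' : Type*} [Fintype Ω] [Fintype Ω'] [Fintype S] [Fintype T] [Fintype T']

/-! The proof is a polarization argument. Adding a variable splits a sample into two independent
samples of half the length (`law_succ`). A set without the new element then sees at least the plus
transform, so its Bhattacharyya parameter is at most the square of the old one (`rmBhatt_lift_le`).
A set containing it sees at most the minus transform, so its bias is at most the square of the old
one (`rmBias_liftInsert_le`). These two quantities square exactly under the transforms, so they are
tracked in place of entropy. `condEntropy_le_bhatt`, `one_sub_bias_le_condEntropy` and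
`bhatt_sq_add_bias_sq_le` translate between them.

Within the sets of size i, coordinate permutations show that {1,…,i} has the largest Bhattacharyya
parameter and {m-i+1,…,m} the largest bias. Hence a single entropy bound at such a set controls a
whole layer.

Let a be the first layer in dimension m where `Hmax` exceeds the midpoint of γ and 1. Below a the
Bhattacharyya parameters are bounded away from 1. By the hypothesis, `Hmin` at a + Δ is bounded
below by a positive constant, so from there on the biases are bounded away from 1. After k more
variables, layers below a have entropy at most a constant times z^(2^k), and layers from a + Δ + k
on have entropy at least 1 - z^(2^k), with z < 1 fixed. Taking k logarithmic in M = m + k makes 2^k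
≥ M^2, which beats the 2^M terms of a union bound. Only Δ + k = o(√M) layers are left undecided,
each a fraction at most 1/√M of all sets (`choose_div_two_pow_le`).

Since the entropies sum to 2^M (1 - C) (`sum_H`), the code of order a - 1 has rate tending to C. Its
error is at most the sum of the entropies of its information bits (`exists_decoder`), which tends to
0. -/

open Classical in
theorem prob_eq_sum_mul (P : Ω → ℝ) (E : Set Ω) :
    prob P E = ∑ ω, P ω * if ω ∈ E then 1 else 0 := by
  simp [prob]

theorem prob_nonneg {P : Ω → ℝ} (hP : ∀ ω, 0 ≤ P ω) (E : Set Ω) : 0 ≤ prob P E :=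
  Finset.sum_nonneg fun ω _ => by split_ifs <;> simp [hP ω]

theorem le_prob {P : Ω → ℝ} (hP : ∀ ω, 0 ≤ P ω) {E : Set Ω} {ω : Ω} (h : ω ∈ E) :
    P ω ≤ prob P E := by
  classical
  have := Finset.single_le_sum (f := fun ω => if ω ∈ E then P ω else 0)
    (fun ω _ => by split_ifs <;> simp [hP ω]) (Finset.mem_univ ω)
  simpa [prob, h] using this

/-- Expectation of a function of `Z`, computed from the law of `Z`. -/
theorem sum_prob_mul (P : Ω → ℝ) (Z : Ω → T) (f : T → ℝ) :
    ∑ t, prob P {ω | Z ω = t} * f t = ∑ ω, P ω * f (Z ω) := by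
  classical
  simp only [prob, Finset.sum_mul, Set.mem_ofPred_eq]
  rw [Finset.sum_comm]
  refine Finset.sum_congr rfl fun ω _ => ?_
  rw [Finset.sum_eq_single (Z ω)] <;> simp +contextual [eq_comm]

theorem sum_prob_and_mul (P : Ω → ℝ) (X : Ω → S) (Z : Ω → T) (f : S → T → ℝ) :
    ∑ s, ∑ t, prob P {ω | X ω = s ∧ Z ω = t} * f s t = ∑ ω, P ω * f (X ω) (Z ω) := by
  have := sum_prob_mul P (fun ω => (X ω, Z ω)) (fun q => f q.1 q.2)
  rw [← this, Fintype.sum_prod_type]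
  simp [Prod.ext_iff]

theorem sum_prob_and {T : Type*} (P : Ω → ℝ) (X : Ω → S) (Z : Ω → T) (t : T) :
    ∑ s, prob P {ω | X ω = s ∧ Z ω = t} = prob P {ω | Z ω = t} := by
  classical
  simp only [prob, Set.mem_ofPred_eq]
  rw [Finset.sum_comm]
  refine Finset.sum_congr rfl fun ω _ => ?_
  rw [Finset.sum_eq_single (X ω)] <;> simp +contextual [eq_comm]

/-- Conditional entropy as a difference of two entropies, each of which depends only on the
partition of the sample space induced by the random variables. -/
theorem condEntropy_eq {P : Ω → ℝ} (hP : ∀ ω, 0 ≤ P ω) (X : Ω → S) (Z : Ω → T) :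
    condEntropy P X Z =
      (-∑ ω, P ω * Real.logb 2 (prob P {ω' | X ω' = X ω ∧ Z ω' = Z ω})) -
        (-∑ ω, P ω * Real.logb 2 (prob P {ω' | Z ω' = Z ω})) := by
  rw [condEntropy, sum_prob_and_mul P X Z fun s t =>
    Real.logb 2 (prob P {ω | X ω = s ∧ Z ω = t} / prob P {ω | Z ω = t}), neg_sub_neg,
    ← Finset.sum_neg_distrib, ← Finset.sum_sub_distrib]
  refine Finset.sum_congr rfl fun ω _ => ?_
  rcases (hP ω).eq_or_lt with h | h
  · simp [← h]
  · have h1 : 0 < prob P {ω' | X ω' = X ω ∧ Z ω' = Z ω} := h.trans_le (le_prob hP (by simp))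
    have h2 : 0 < prob P {ω' | Z ω' = Z ω} := h.trans_le (le_prob hP (by simp))
    rw [Real.logb_div h1.ne' h2.ne']
    ring

/-- There is an estimator of `X` from `Z` whose error probability is at most `H(X | Z)`. -/
theorem exists_estimator [Nonempty S] {P : Ω → ℝ} (hP : ∀ ω, 0 ≤ P ω) (X : Ω → S) (Z : Ω → T) :
    ∃ g : T → S, prob P {ω | g (Z ω) ≠ X ω} ≤ condEntropy P X Z := by
  classical
  -- The estimator is the maximum a posteriori rule.
  have hmax : ∀ t, ∃ s, ∀ s', prob P {ω | X ω = s' ∧ Z ω = t} ≤ prob P {ω | X ω = s ∧ Z ω = t} :=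
    fun t => Finite.exists_max _
  choose g hg using hmax
  refine ⟨g, ?_⟩
  have h1 : prob P {ω | g (Z ω) ≠ X ω} =
      ∑ s, ∑ t, prob P {ω | X ω = s ∧ Z ω = t} * if g t ≠ s then 1 else 0 := by
    rw [sum_prob_and_mul P X Z fun s t => if g t ≠ s then (1 : ℝ) else 0, prob_eq_sum_mul]
    simp
  rw [h1, condEntropy, ← Finset.sum_neg_distrib]
  refine Finset.sum_le_sum fun s _ => ?_
  rw [← Finset.sum_neg_distrib]
  refine Finset.sum_le_sum fun t _ => ?_
  set p := prob P {ω | X ω = s ∧ Z ω = t} with hp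
  set q := prob P {ω | Z ω = t} with hq
  have hp0 : 0 ≤ p := prob_nonneg hP _
  have hsum := sum_prob_and P X Z t
  have hpq : p ≤ q := by
    rw [hq, ← hsum]
    exact Finset.single_le_sum (f := fun s => prob P {ω | X ω = s ∧ Z ω = t})
      (fun s _ => prob_nonneg hP _) (Finset.mem_univ s)
  rcases hp0.eq_or_lt with h0 | h0
  · simp [← h0]
  have hq0 : 0 < q := h0.trans_le hpq
  split_ifs with h
  -- A value other than the chosen one has posterior at most 1/2, so it carries at least one bit of
  -- surprise.
  · have h2 : 2 * p ≤ q := by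
      have h3 : p + prob P {ω | X ω = g t ∧ Z ω = t} ≤ q := by
        rw [hq, ← hsum, hp, ← Finset.sum_pair (f := fun s => prob P {ω | X ω = s ∧ Z ω = t}) h.symm]
        exact Finset.sum_le_univ_sum_of_nonneg fun s => prob_nonneg hP _
      have := hg t s
      linarith
    have h4 : Real.logb 2 (p / q) ≤ -1 := by
      rw [Real.logb_le_iff_le_rpow one_lt_two (by positivity), Real.rpow_neg_one,
        div_le_iff₀ hq0]
      linarith
    nlinarith
  · have h4 : Real.logb 2 (p / q) ≤ 0 :=
      Real.logb_nonpos one_lt_two (by positivity) ((div_le_one hq0).2 hpq)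
    nlinarith

/-- The Bhattacharyya parameter of the bit `X` given `Z`. -/
noncomputable def bhatt (P : Ω → ℝ) (X : Ω → ZMod 2) (Z : Ω → T) : ℝ :=
  ∑ t, 2 * √(prob P {ω | X ω = 0 ∧ Z ω = t} * prob P {ω | X ω = 1 ∧ Z ω = t})

/-- The bias of the bit `X` given `Z`, that is, one minus twice the error probability of the best
estimator. -/
noncomputable def bias (P : Ω → ℝ) (X : Ω → ZMod 2) (Z : Ω → T) : ℝ :=
  ∑ t, |prob P {ω | X ω = 0 ∧ Z ω = t} - prob P {ω | X ω = 1 ∧ Z ω = t}|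

theorem bhatt_nonneg (P : Ω → ℝ) (X : Ω → ZMod 2) (Z : Ω → T) : 0 ≤ bhatt P X Z :=
  Finset.sum_nonneg fun _ _ => by positivity

theorem bias_nonneg (P : Ω → ℝ) (X : Ω → ZMod 2) (Z : Ω → T) : 0 ≤ bias P X Z :=
  Finset.sum_nonneg fun _ _ => abs_nonneg _

/-- The contribution to the conditional entropy of a bit of an observation which has joint
probabilities `a` and `b` with the two values of the bit. -/
noncomputable def bitEntropy (a b : ℝ) : ℝ :=
  -(a * Real.logb 2 (a / (a + b)) + b * Real.logb 2 (b / (a + b)))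

theorem sum_zmod_two {M : Type*} [AddCommMonoid M] (f : ZMod 2 → M) : ∑ x, f x = f 0 + f 1 :=
  Fin.sum_univ_two f

theorem prob_zero_add_prob_one {T : Type*} (P : Ω → ℝ) (X : Ω → ZMod 2) (Z : Ω → T) (t : T) :
    prob P {ω | X ω = 0 ∧ Z ω = t} + prob P {ω | X ω = 1 ∧ Z ω = t} = prob P {ω | Z ω = t} := by
  rw [← sum_prob_and P X Z t, sum_zmod_two]

theorem condEntropy_bit (P : Ω → ℝ) (X : Ω → ZMod 2) (Z : Ω → T) :
    condEntropy P X Z =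
      ∑ t, bitEntropy (prob P {ω | X ω = 0 ∧ Z ω = t}) (prob P {ω | X ω = 1 ∧ Z ω = t}) := by
  rw [condEntropy, sum_zmod_two, ← Finset.sum_add_distrib, ← Finset.sum_neg_distrib]
  simp only [bitEntropy, prob_zero_add_prob_one]

/-! ### Bounds for the binary entropy -/

theorem bitEntropy_eq {a b : ℝ} (h : 0 < a + b) :
    bitEntropy a b = (a + b) * (Real.binEntropy (a / (a + b)) / Real.log 2) := by
  have hb' : 1 - a / (a + b) = b / (a + b) := by field_simp; ring
  rw [Real.binEntropy_eq_negMulLog_add_negMulLog_one_sub, hb', Real.negMulLog, Real.negMulLog,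
    bitEntropy, Real.logb, Real.logb]
  field_simp
  ring

theorem bitEntropy_le_add {a b : ℝ} (ha : 0 ≤ a) (hb : 0 ≤ b) : bitEntropy a b ≤ a + b := by
  rcases (add_nonneg ha hb).eq_or_lt with h | h
  · have ha0 : a = 0 := by linarith
    have hb0 : b = 0 := by linarith
    simp [bitEntropy, ha0, hb0]
  · rw [bitEntropy_eq h]
    have : Real.binEntropy (a / (a + b)) / Real.log 2 ≤ 1 :=
      (div_le_one (Real.log_pos one_lt_two)).2 Real.binEntropy_le_log_two
    nlinarith

/-- By concavity the graph lies above its chord from 0 to 1/2. -/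
theorem two_mul_log_two_mul_le_binEntropy {p : ℝ} (h0 : 0 ≤ p) (h1 : p ≤ 1 / 2) :
    2 * p * Real.log 2 ≤ Real.binEntropy p := by
  have hc : ConcaveOn ℝ (Set.Icc 0 1) Real.binEntropy := Real.strictConcave_binEntropy.concaveOn
  have h := hc.right (show (0 : ℝ) ∈ Set.Icc 0 1 by simp)
    (show (2⁻¹ : ℝ) ∈ Set.Icc 0 1 by norm_num) (show 0 ≤ 1 - 2 * p by linarith)
    (show 0 ≤ 2 * p by linarith) (by ring)
  simp only [smul_eq_mul, Real.binEntropy_zero, Real.binEntropy_two_inv] at h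
  have h2 : (1 - 2 * p) * 0 + 2 * p * 2⁻¹ = p := by ring
  rw [h2] at h
  linarith

/-- The left side is twice the smaller of the two masses, so the chord bound applies to the smaller
posterior. -/
theorem add_sub_abs_le_bitEntropy {a b : ℝ} (ha : 0 ≤ a) (hb : 0 ≤ b) :
    a + b - |a - b| ≤ bitEntropy a b := by
  wlog hab : a ≤ b generalizing a b
  · have := this hb ha (le_of_not_ge hab)
    rw [abs_sub_comm, bitEntropy, add_comm a b, add_comm (a * _)]
    simpa [bitEntropy] using this
  rcases (add_nonneg ha hb).eq_or_lt with h | h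
  · have ha0 : a = 0 := by linarith
    have hb0 : b = 0 := by linarith
    simp [bitEntropy, ha0, hb0]
  · rw [bitEntropy_eq h, abs_of_nonpos (by linarith)]
    have h1 := two_mul_log_two_mul_le_binEntropy (p := a / (a + b)) (by positivity)
      (by rw [div_le_iff₀ h]; linarith)
    have h2 : 2 * (a / (a + b)) ≤ Real.binEntropy (a / (a + b)) / Real.log 2 := by
      rwa [le_div_iff₀ (Real.log_pos one_lt_two)]
    have h3 := mul_le_mul_of_nonneg_left h2 h.le
    have h4 : (a + b) * (2 * (a / (a + b))) = 2 * a := by field_simp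
    linarith

/-- Apply log x ≤ x - 1 to x = 1/√p to get -p log p ≤ 2√p(1 - √p), then use 1 - √p ≤ √(1 - p). -/
theorem negMulLog_le_sqrt {p : ℝ} (h0 : 0 ≤ p) (h1 : p ≤ 1) :
    Real.negMulLog p ≤ 2 * √(p * (1 - p)) := by
  rcases h0.eq_or_lt with h | h
  · simp [← h]
  have hs : 0 < √p := Real.sqrt_pos.2 h
  have hs2 : √p * √p = p := Real.mul_self_sqrt h0
  have hs1 : √p ≤ 1 := by simpa using h1
  have hlog : Real.log p = -(2 * Real.log (√p)⁻¹) := by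
    rw [Real.log_inv, Real.log_sqrt h0]; ring
  have h2 := Real.log_le_sub_one_of_pos (inv_pos.2 hs)
  have h3 : Real.negMulLog p ≤ p * (2 * ((√p)⁻¹ - 1)) := by
    rw [Real.negMulLog, hlog]; nlinarith
  have h4 : p * (2 * ((√p)⁻¹ - 1)) = 2 * (√p * (1 - √p)) := by
    nth_rewrite 1 [← hs2]; field_simp
  have h5 : 1 - √p ≤ √(1 - p) := by
    refine Real.le_sqrt_of_sq_le ?_
    nlinarith
  rw [Real.sqrt_mul h0]
  nlinarith

theorem bitEntropy_le_sqrt {a b : ℝ} (ha : 0 ≤ a) (hb : 0 ≤ b) :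
    bitEntropy a b ≤ 2 / Real.log 2 * (2 * √(a * b)) := by
  rcases (add_nonneg ha hb).eq_or_lt with h | h
  · have ha0 : a = 0 := by linarith
    have hb0 : b = 0 := by linarith
    simp [bitEntropy, ha0, hb0]
  · rw [bitEntropy_eq h]
    set p := a / (a + b) with hp
    have hp0 : 0 ≤ p := by positivity
    have hp1 : p ≤ 1 := (div_le_one h).2 (by linarith)
    have hb' : 1 - p = b / (a + b) := by rw [hp]; field_simp; ring
    have h1 := negMulLog_le_sqrt hp0 hp1
    have h2 := negMulLog_le_sqrt (p := 1 - p) (by linarith) (by linarith)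
    rw [sub_sub_cancel, mul_comm (1 - p)] at h2
    have h3 : √(a * b) = (a + b) * √(p * (1 - p)) := by
      have : a * b = (a + b) ^ 2 * (p * (1 - p)) := by rw [hb', hp]; field_simp
      rw [this, Real.sqrt_mul (by positivity), Real.sqrt_sq h.le]
    rw [h3, Real.binEntropy_eq_negMulLog_add_negMulLog_one_sub]
    have hl := Real.log_pos one_lt_two
    have h4 : (a + b) * ((Real.negMulLog p + Real.negMulLog (1 - p)) / Real.log 2) ≤
        (a + b) * ((4 * √(p * (1 - p))) / Real.log 2) := by
      gcongr; linarith
    refine h4.trans (le_of_eq ?_)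
    ring

/-! ### Entropy, Bhattacharyya parameter and bias of a bit -/

theorem sum_prob (P : Ω → ℝ) (Z : Ω → T) : ∑ t, prob P {ω | Z ω = t} = ∑ ω, P ω := by
  simpa using sum_prob_mul P Z fun _ => 1

theorem sum_prob_bit {P : Ω → ℝ} (hP1 : ∑ ω, P ω = 1) (X : Ω → ZMod 2) (Z : Ω → T) :
    ∑ t, (prob P {ω | X ω = 0 ∧ Z ω = t} + prob P {ω | X ω = 1 ∧ Z ω = t}) = 1 := by
  simp only [prob_zero_add_prob_one, sum_prob, hP1]

theorem condEntropy_bit_le_one {P : Ω → ℝ} (hP : ∀ ω, 0 ≤ P ω) (hP1 : ∑ ω, P ω = 1)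
    (X : Ω → ZMod 2) (Z : Ω → T) : condEntropy P X Z ≤ 1 := by
  rw [condEntropy_bit, ← sum_prob_bit hP1 X Z]
  exact Finset.sum_le_sum fun t _ => bitEntropy_le_add (prob_nonneg hP _) (prob_nonneg hP _)

theorem one_sub_bias_le_condEntropy {P : Ω → ℝ} (hP : ∀ ω, 0 ≤ P ω) (hP1 : ∑ ω, P ω = 1)
    (X : Ω → ZMod 2) (Z : Ω → T) : 1 - bias P X Z ≤ condEntropy P X Z := by
  rw [condEntropy_bit, ← sum_prob_bit hP1 X Z, bias, ← Finset.sum_sub_distrib]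
  exact Finset.sum_le_sum fun t _ =>
    add_sub_abs_le_bitEntropy (prob_nonneg hP _) (prob_nonneg hP _)

theorem condEntropy_le_bhatt {P : Ω → ℝ} (hP : ∀ ω, 0 ≤ P ω)
    (X : Ω → ZMod 2) (Z : Ω → T) : condEntropy P X Z ≤ 2 / Real.log 2 * bhatt P X Z := by
  rw [condEntropy_bit, bhatt, Finset.mul_sum]
  exact Finset.sum_le_sum fun t _ => bitEntropy_le_sqrt (prob_nonneg hP _) (prob_nonneg hP _)

theorem bias_le_one {P : Ω → ℝ} (hP : ∀ ω, 0 ≤ P ω) (hP1 : ∑ ω, P ω = 1)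
    (X : Ω → ZMod 2) (Z : Ω → T) : bias P X Z ≤ 1 := by
  rw [← sum_prob_bit hP1 X Z]
  refine Finset.sum_le_sum fun t _ => ?_
  have h0 := prob_nonneg hP {ω | X ω = 0 ∧ Z ω = t}
  have h1 := prob_nonneg hP {ω | X ω = 1 ∧ Z ω = t}
  rw [abs_le]
  constructor <;> linarith

/-- Cauchy–Schwarz, from 4ab = (a + b - |a - b|)(a + b + |a - b|): the two factors sum over t to one
minus and one plus the bias. -/
theorem bhatt_sq_add_bias_sq_le {P : Ω → ℝ} (hP : ∀ ω, 0 ≤ P ω) (hP1 : ∑ ω, P ω = 1)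
    (X : Ω → ZMod 2) (Z : Ω → T) : bhatt P X Z ^ 2 + bias P X Z ^ 2 ≤ 1 := by
  set a := fun t => prob P {ω | X ω = 0 ∧ Z ω = t} with ha
  set b := fun t => prob P {ω | X ω = 1 ∧ Z ω = t} with hb
  have ha0 : ∀ t, 0 ≤ a t := fun t => prob_nonneg hP _
  have hb0 : ∀ t, 0 ≤ b t := fun t => prob_nonneg hP _
  have hab : ∑ t, (a t + b t) = 1 := sum_prob_bit hP1 X Z
  have hcs := Finset.sum_sq_le_sum_mul_sum_of_sq_le_mul Finset.univ
    (r := fun t => 2 * √(a t * b t))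
    (f := fun t => (a t + b t) - |a t - b t|) (g := fun t => (a t + b t) + |a t - b t|)
    (fun t _ => by
      have := ha0 t; have := hb0 t
      rcases abs_cases (a t - b t) with h | h <;> linarith)
    (fun t _ => by have := ha0 t; have := hb0 t; positivity)
    (fun t _ => by
      have h1 : √(a t * b t) ^ 2 = a t * b t := Real.sq_sqrt (mul_nonneg (ha0 t) (hb0 t))
      have h2 := sq_abs (a t - b t)
      rw [mul_pow, h1]
      linear_combination h2)
  rw [Finset.sum_sub_distrib, Finset.sum_add_distrib (g := fun t => |a t - b t|), hab] at hcs
  have hbias : bias P X Z = ∑ t, |a t - b t| := rfl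
  have hbh : bhatt P X Z = ∑ t, 2 * √(a t * b t) := rfl
  rw [hbias, hbh]
  nlinarith

/-! ### Data processing -/

/-- The joint law of a bit and an observation as seen through a finer observation `Z'` on another
sample space. -/
theorem prob_eq_sum_fiber {S T : Type*} {P : Ω → ℝ} {P' : Ω' → ℝ} {X : Ω → S} {X' : Ω' → S}
    {Z : Ω → T} {Z' : Ω' → T'} [DecidableEq T] {e : Ω' → Ω} {g : T' → T}
    (he : ∀ f : Ω → ℝ, ∑ ω, P' ω * f (e ω) = ∑ ω, P ω * f ω)
    (hX : ∀ ω, X' ω = X (e ω)) (hg : ∀ ω, Z (e ω) = g (Z' ω)) (s : S) (t : T) :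
    prob P {ω | X ω = s ∧ Z ω = t} =
      ∑ t' with g t' = t, prob P' {ω | X' ω = s ∧ Z' ω = t'} := by
  classical
  rw [prob_eq_sum_mul, ← he, Finset.sum_filter]
  have : ∀ t', (if g t' = t then prob P' {ω | X' ω = s ∧ Z' ω = t'} else 0) =
      ∑ ω, if g t' = t ∧ X' ω = s ∧ Z' ω = t' then P' ω else 0 := by
    intro t'
    split_ifs with h
    · simp only [prob, h, true_and, Set.mem_ofPred_eq]
      congr! 2
    · simp [h]
  simp only [this]
  rw [Finset.sum_comm]
  refine Finset.sum_congr rfl fun ω _ => ?_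
  rw [Finset.sum_eq_single (Z' ω)]
  · simp [← hX, hg, and_comm]
  · intro t' _ ht'
    simp [ht'.symm]
  · simp

/-- This lets "finer" be checked as an implication between equalities of observations, with no
explicit map between their values. -/
theorem exists_factor {Ω Ω' T T' : Type*} [Nonempty Ω] {Z : Ω → T} {Z' : Ω' → T'} {e : Ω' → Ω}
    (hZ : ∀ ω ω', Z' ω = Z' ω' → Z (e ω) = Z (e ω')) : ∃ g : T' → T, ∀ ω, Z (e ω) = g (Z' ω) := by
  have : Nonempty T := ‹Nonempty Ω›.map Z
  obtain ⟨g, hg⟩ := (Function.factorsThrough_iff (f := Z') (fun ω => Z (e ω))).1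
    (fun ω ω' h => hZ ω ω' h)
  exact ⟨g, fun ω => congrFun hg ω⟩

/-- Data processing: a finer observation has a smaller Bhattacharyya parameter. -/
theorem bhatt_le [Nonempty Ω] {P : Ω → ℝ} {P' : Ω' → ℝ} {X : Ω → ZMod 2} {X' : Ω' → ZMod 2}
    {Z : Ω → T} {Z' : Ω' → T'} (e : Ω' → Ω) (hP' : ∀ ω, 0 ≤ P' ω)
    (he : ∀ f : Ω → ℝ, ∑ ω, P' ω * f (e ω) = ∑ ω, P ω * f ω)
    (hX : ∀ ω, X' ω = X (e ω)) (hZ : ∀ ω ω', Z' ω = Z' ω' → Z (e ω) = Z (e ω')) :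
    bhatt P' X' Z' ≤ bhatt P X Z := by
  classical
  obtain ⟨g, hg⟩ := exists_factor hZ
  rw [bhatt, bhatt, ← Finset.sum_fiberwise _ g]
  refine Finset.sum_le_sum fun t _ => ?_
  rw [prob_eq_sum_fiber he hX hg, prob_eq_sum_fiber he hX hg, ← Finset.mul_sum]
  gcongr
  -- Cauchy–Schwarz on each fibre of the coarsening map.
  rw [Real.sqrt_mul (Finset.sum_nonneg fun _ _ => prob_nonneg hP' _)]
  refine le_trans (le_of_eq ?_) (Real.sum_sqrt_mul_sqrt_le _
    (fun _ => prob_nonneg hP' _) (fun _ => prob_nonneg hP' _))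
  exact Finset.sum_congr rfl fun _ _ => Real.sqrt_mul (prob_nonneg hP' _) _

/-- Data processing: a finer observation has a larger bias. -/
theorem bias_le [Nonempty Ω] {P : Ω → ℝ} {P' : Ω' → ℝ} {X : Ω → ZMod 2} {X' : Ω' → ZMod 2}
    {Z : Ω → T} {Z' : Ω' → T'} (e : Ω' → Ω)
    (he : ∀ f : Ω → ℝ, ∑ ω, P' ω * f (e ω) = ∑ ω, P ω * f ω)
    (hX : ∀ ω, X' ω = X (e ω)) (hZ : ∀ ω ω', Z' ω = Z' ω' → Z (e ω) = Z (e ω')) :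
    bias P X Z ≤ bias P' X' Z' := by
  classical
  obtain ⟨g, hg⟩ := exists_factor hZ
  rw [bias, bias, ← Finset.sum_fiberwise _ g]
  refine Finset.sum_le_sum fun t _ => ?_
  rw [prob_eq_sum_fiber he hX hg, prob_eq_sum_fiber he hX hg, ← Finset.sum_sub_distrib]
  exact Finset.abs_sum_le_sum_abs _ _

/-! ### The plus and minus transforms -/

/-- Two independent copies of a mass function. -/
def square (P : Ω → ℝ) : Ω × Ω → ℝ := fun ω => P ω.1 * P ω.2

theorem sum_square_mul_fst {P : Ω → ℝ} (hP1 : ∑ ω, P ω = 1) (f : Ω → ℝ) :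
    ∑ ω, square P ω * f ω.1 = ∑ ω, P ω * f ω := by
  simp only [square, Fintype.sum_prod_type]
  refine Finset.sum_congr rfl fun ω _ => ?_
  rw [← Finset.sum_mul, ← Finset.mul_sum, hP1, mul_one]

theorem prob_square (P : Ω → ℝ) (E F : Set Ω) :
    prob (square P) {ω | ω.1 ∈ E ∧ ω.2 ∈ F} = prob P E * prob P F := by
  classical
  simp only [prob_eq_sum_mul, Finset.sum_mul_sum, Fintype.sum_prod_type, square]
  refine Finset.sum_congr rfl fun ω _ => Finset.sum_congr rfl fun ω' _ => ?_
  by_cases h : ω ∈ E <;> by_cases h' : ω' ∈ F <;> simp [h, h']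

/-- The Bhattacharyya parameter is squared under the plus transform. -/
theorem bhatt_plus {P : Ω → ℝ} (hP : ∀ ω, 0 ≤ P ω) (X : Ω → ZMod 2) (Z : Ω → T) :
    bhatt (square P) (fun ω => X ω.1) (fun ω => ((Z ω.1, Z ω.2), X ω.1 + X ω.2)) =
      bhatt P X Z ^ 2 := by
  have key : ∀ (s v : ZMod 2) (t t' : T),
      prob (square P) {ω | X ω.1 = s ∧ ((Z ω.1, Z ω.2), X ω.1 + X ω.2) = ((t, t'), v)} =
      prob P {ω | X ω = s ∧ Z ω = t} * prob P {ω | X ω = s + v ∧ Z ω = t'} := by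
    intro s v t t'
    rw [← prob_square]
    congr 1
    ext ω
    simp only [Set.mem_ofPred_eq, Prod.mk.injEq]
    constructor
    · rintro ⟨rfl, ⟨rfl, rfl⟩, rfl⟩
      simp [← add_assoc, CharTwo.add_self_eq_zero]
    · rintro ⟨⟨rfl, rfl⟩, h, rfl⟩
      simp [h, ← add_assoc, CharTwo.add_self_eq_zero]
  have h0 : ∀ (s : ZMod 2) t, 0 ≤ prob P {ω | X ω = s ∧ Z ω = t} := fun s t => prob_nonneg hP _
  simp only [bhatt, Fintype.sum_prod_type, sum_zmod_two, key, zero_add, add_zero]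
  rw [show (1 : ZMod 2) + 1 = 0 from rfl, sq, Finset.sum_mul_sum]
  refine Finset.sum_congr rfl fun t _ => Finset.sum_congr rfl fun t' _ => ?_
  -- Both values of the revealed sum give the same term 2√(ab)√(cd); together they make the product
  -- of the two summands.
  have h1 : ∀ a b c d : ℝ, 0 ≤ a → 0 ≤ b → √(a * c * (b * d)) = √(a * b) * √(c * d) :=
    fun a b c d ha hb => by rw [mul_mul_mul_comm, Real.sqrt_mul (mul_nonneg ha hb)]
  rw [h1 _ _ _ _ (h0 _ _) (h0 _ _), h1 _ _ _ _ (h0 _ _) (h0 _ _),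
    mul_comm (prob P {ω | X ω = 1 ∧ Z ω = t'})]
  ring

/-- The bias is squared under the minus transform. -/
theorem bias_minus (P : Ω → ℝ) (X : Ω → ZMod 2) (Z : Ω → T) :
    bias (square P) (fun ω => X ω.1 + X ω.2) (fun ω => (Z ω.1, Z ω.2)) = bias P X Z ^ 2 := by
  have key : ∀ (s : ZMod 2) (t t' : T),
      prob (square P) {ω | X ω.1 + X ω.2 = s ∧ (Z ω.1, Z ω.2) = (t, t')} =
      prob P {ω | X ω = 0 ∧ Z ω = t} * prob P {ω | X ω = s ∧ Z ω = t'} +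
      prob P {ω | X ω = 1 ∧ Z ω = t} * prob P {ω | X ω = s + 1 ∧ Z ω = t'} := by
    intro s t t'
    rw [← prob_square, ← prob_square]
    have h := sum_prob_and (square P) (fun ω => X ω.1)
      (fun ω => (X ω.1 + X ω.2, (Z ω.1, Z ω.2))) (s, (t, t'))
    simp only [Prod.mk.injEq (X _ + X _)] at h
    rw [← h, sum_zmod_two]
    congr 2 <;> ext ω <;> simp only [Set.mem_ofPred_eq, Prod.mk.injEq]
    · constructor
      · rintro ⟨h0, rfl, rfl, rfl⟩
        simp [h0]
      · rintro ⟨⟨h0, rfl⟩, rfl, rfl⟩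
        simp [h0]
    · constructor
      · rintro ⟨h0, rfl, rfl, rfl⟩
        refine ⟨⟨h0, rfl⟩, ?_, rfl⟩
        rw [h0]
        generalize X ω.2 = x
        revert x
        decide
      · rintro ⟨⟨h0, rfl⟩, h1, rfl⟩
        refine ⟨h0, ?_, rfl, rfl⟩
        rw [h0, h1]
        clear * -
        revert s
        decide
  simp only [bias, Fintype.sum_prod_type, key]
  rw [show (1 : ZMod 2) + 1 = 0 from rfl, zero_add, sq, Finset.sum_mul_sum]
  refine Finset.sum_congr rfl fun t _ => Finset.sum_congr rfl fun t' _ => ?_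
  -- The identity is (ac + bd) - (ad + bc) = (a - b)(c - d).
  rw [← abs_mul]
  congr 1
  ring

end Info
/-! ### The Plotkin decomposition -/

section Plotkin

variable {m : ℕ}

/-- A subset of `{1, …, m}` as a subset of `{1, …, m + 1}`. -/
def lift (A : Finset (Fin m)) : Finset (Fin (m + 1)) := A.map Fin.castSuccEmb

/-- The union of a subset of `{1, …, m}` with `{m + 1}`. -/
def liftInsert (A : Finset (Fin m)) : Finset (Fin (m + 1)) := insert (Fin.last m) (lift A)

theorem last_notMem_lift (A : Finset (Fin m)) : Fin.last m ∉ lift A := by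
  simp [lift, Fin.castSucc_ne_last]

theorem last_mem_liftInsert (A : Finset (Fin m)) : Fin.last m ∈ liftInsert A :=
  Finset.mem_insert_self _ _

theorem lift_injective : Function.Injective (lift (m := m)) := Finset.map_injective _

theorem liftInsert_injective : Function.Injective (liftInsert (m := m)) := fun A B h =>
  lift_injective <| by
    rw [← Finset.erase_insert (last_notMem_lift A), ← Finset.erase_insert (last_notMem_lift B)]
    exact congrArg (fun C => Finset.erase C (Fin.last m)) h

@[simp] theorem card_lift (A : Finset (Fin m)) : (lift A).card = A.card := Finset.card_map _

@[simp] theorem card_liftInsert (A : Finset (Fin m)) : (liftInsert A).card = A.card + 1 := by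
  rw [liftInsert, Finset.card_insert_of_notMem (last_notMem_lift A), card_lift]

theorem lift_bijective :
    Function.Bijective (Sum.elim lift liftInsert :
      Finset (Fin m) ⊕ Finset (Fin m) → Finset (Fin (m + 1))) := by
  rw [Fintype.bijective_iff_injective_and_card]
  constructor
  · refine lift_injective.sumElim liftInsert_injective fun A B h => ?_
    exact last_notMem_lift A (h ▸ last_mem_liftInsert B)
  · simp [pow_succ, mul_two]

theorem eq_lift_or_eq_liftInsert (C : Finset (Fin (m + 1))) :
    (∃ B, C = lift B) ∨ ∃ B, C = liftInsert B := by
  obtain ⟨B | B, rfl⟩ := lift_bijective.2 C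
  · exact Or.inl ⟨B, rfl⟩
  · exact Or.inr ⟨B, rfl⟩

theorem sum_finset_succ {M : Type*} [AddCommMonoid M] (f : Finset (Fin (m + 1)) → M) :
    ∑ C, f C = ∑ B, f (lift B) + ∑ B, f (liftInsert B) := by
  rw [← lift_bijective.sum_comp f, Fintype.sum_sum_type]
  rfl

theorem prod_cube_succ {M : Type*} [CommMonoid M] (f : Cube (m + 1) → M) :
    ∏ z, f z = (∏ z : Cube m, f (Fin.snoc z 0 : Cube (m + 1))) *
      ∏ z : Cube m, f (Fin.snoc z 1 : Cube (m + 1)) := by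
  rw [← (Fin.snocEquiv fun _ => ZMod 2).prod_comp, Fintype.prod_prod_type]
  exact Fin.prod_univ_two (fun b : ZMod 2 => ∏ z : Cube m, f (Fin.snoc z b : Cube (m + 1)))

theorem evalVec_lift (A : Finset (Fin m)) (z : Cube m) (b : ZMod 2) :
    evalVec (lift A) (Fin.snoc z b : Cube (m + 1)) = evalVec A z := by
  simp [evalVec, lift]

theorem evalVec_liftInsert (A : Finset (Fin m)) (z : Cube m) (b : ZMod 2) :
    evalVec (liftInsert A) (Fin.snoc z b : Cube (m + 1)) = b * evalVec A z := by
  rw [← evalVec_lift A z b, evalVec, liftInsert, Finset.prod_insert (last_notMem_lift A), evalVec,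
    Fin.snoc_last]

/-! ### The encoding map -/

theorem encode_apply (u : Finset (Fin m) → ZMod 2) (z : Cube m) :
    encode u z = ∑ A, u A * evalVec A z := by
  simp [encode]

theorem encode_add (u v : Finset (Fin m) → ZMod 2) : encode (u + v) = encode u + encode v := by
  simp [encode, add_smul, Finset.sum_add_distrib]

/-- This is the (u, u + v) construction: the two faces of the cube carry u and u + v. -/
theorem encode_snoc (u : Finset (Fin (m + 1)) → ZMod 2) (z : Cube m) (b : ZMod 2) :
    encode u (Fin.snoc z b : Cube (m + 1)) =
      encode (fun B => u (lift B)) z + b * encode (fun B => u (liftInsert B)) z := by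
  simp only [encode_apply, sum_finset_succ, evalVec_lift, evalVec_liftInsert, Finset.mul_sum]
  simp only [mul_left_comm]

theorem eq_zero_of_encode_eq_zero {m : ℕ} {u : Finset (Fin m) → ZMod 2} (h : encode u = 0) :
    u = 0 := by
  induction m with
  | zero =>
    have h0 := congrFun h 0
    rw [encode_apply, Fintype.sum_unique] at h0
    funext A
    rw [Subsingleton.elim A default]
    simpa [evalVec, Finset.eq_empty_of_isEmpty] using h0
  | succ m ih =>
    have h0 : encode (fun B => u (lift B)) = 0 := by
      funext z
      have := congrFun h (Fin.snoc z 0)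
      rw [encode_snoc] at this
      simpa using this
    have h1 : encode (fun B => u (liftInsert B)) = 0 := by
      funext z
      have := congrFun h (Fin.snoc z 1)
      rw [encode_snoc, h0] at this
      simpa using this
    funext C
    obtain ⟨B, rfl⟩ | ⟨B, rfl⟩ := eq_lift_or_eq_liftInsert C
    · exact congrFun (ih h0) B
    · exact congrFun (ih h1) B

theorem linearIndependent_evalVec :
    LinearIndependent (ZMod 2) (evalVec : Finset (Fin m) → Cube m → ZMod 2) :=
  Fintype.linearIndependent_iff.2 fun _ hu => congrFun (eq_zero_of_encode_eq_zero hu)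

/-- Consequently the transmitted word is uniform on all words. -/
theorem encode_bijective : Function.Bijective (encode (m := m)) := by
  rw [Fintype.bijective_iff_injective_and_card]
  constructor
  · intro u v h
    have : encode (u + v) = 0 := by
      rw [encode_add, h]
      exact CharTwo.add_self_eq_zero _
    exact CharTwo.add_eq_zero.1 (eq_zero_of_encode_eq_zero this)
  · simp

theorem rate_reedMuller (r : ℤ) :
    rate (reedMuller m r) =
      ((Finset.univ.filter fun A : Finset (Fin m) => (A.card : ℤ) ≤ r).card : ℝ) / 2 ^ m := by
  have h := finrank_span_eq_card (linearIndependent_evalVec.comp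
    (Subtype.val : {A : Finset (Fin m) // (A.card : ℤ) ≤ r} → _) Subtype.val_injective)
  rw [← Fintype.card_subtype, ← h, rate, reedMuller, Set.image_eq_range]
  rfl

theorem exists_encode_of_mem_reedMuller {r : ℤ} {x : Cube m → ZMod 2} (hx : x ∈ reedMuller m r) :
    ∃ u, encode u = x ∧ ∀ A : Finset (Fin m), r < A.card → u A = 0 := by
  induction hx using Submodule.span_induction with
  | mem x hx =>
    obtain ⟨A, hA, rfl⟩ := hx
    refine ⟨Pi.single A 1, ?_, fun B hB => ?_⟩
    · simp [encode, Pi.single_apply]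
    · refine Pi.single_eq_of_ne ?_ _
      rintro rfl
      exact absurd hA (not_le.2 hB)
  | zero => exact ⟨0, by simp [encode], fun _ _ => rfl⟩
  | add x y _ _ hx hy =>
    obtain ⟨u, rfl, hu⟩ := hx
    obtain ⟨v, rfl, hv⟩ := hy
    exact ⟨u + v, encode_add u v, fun A hA => by simp [hu A hA, hv A hA]⟩
  | smul a x _ hx =>
    obtain ⟨u, rfl, hu⟩ := hx
    exact ⟨a • u, by simp [encode, Finset.smul_sum, smul_smul], fun A hA => by simp [hu A hA]⟩

/-! ### Compatibility of the order with adding an element -/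

theorem toColex_lift_lt {A B : Finset (Fin m)} :
    toColex (lift A) < toColex (lift B) ↔ toColex A < toColex B := by
  rw [lift, lift, Finset.map_eq_image, Finset.map_eq_image]
  exact Finset.Colex.toColex_image_lt_toColex_image Fin.strictMono_castSucc

theorem toColex_liftInsert_lt {A B : Finset (Fin m)} :
    toColex (liftInsert A) < toColex (liftInsert B) ↔ toColex A < toColex B := by
  rw [← toColex_lift_lt (A := A), ← Finset.Colex.toColex_sdiff_lt_toColex_sdiff
    (u := {Fin.last m}) (by simp [last_mem_liftInsert]) (by simp [last_mem_liftInsert])]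
  have h : ∀ C : Finset (Fin m), liftInsert C \ {Fin.last m} = lift C := fun C => by
    rw [Finset.sdiff_singleton_eq_erase, liftInsert, Finset.erase_insert (last_notMem_lift C)]
  rw [h, h]

theorem RMLt.lift {A B : Finset (Fin m)} (h : RMLt A B) : RMLt (lift A) (lift B) := by
  simpa only [RMLt, card_lift, toColex_lift_lt] using h

theorem rmLt_liftInsert_iff {A B : Finset (Fin m)} :
    RMLt (liftInsert A) (liftInsert B) ↔ RMLt A B := by
  simp [RMLt, toColex_liftInsert_lt]

theorem rmLt_liftInsert_lift {A B : Finset (Fin m)} (h : B.card ≤ A.card) :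
    RMLt (liftInsert A) (RMPolar.lift B) :=
  Or.inl (by simp; omega)

/-- A set without the new element can precede one with it only if it is at least as large, and
removing the new element makes that strict. -/
theorem rmLt_of_lift_liftInsert {A B : Finset (Fin m)}
    (h : RMLt (RMPolar.lift A) (liftInsert B)) : RMLt A B := by
  left
  rcases h with h | h
  · simp at h; omega
  · have := h.1; simp at this; omega

end Plotkin

/-! ### The strict total order on subsets -/

section Order

variable {m : ℕ} {A B C : Finset (Fin m)}

theorem RMLt.card_le (h : RMLt A B) : B.card ≤ A.card := by
  rcases h with h | h
  · exact h.le
  · exact h.1.ge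

theorem RMLt.irrefl (A : Finset (Fin m)) : ¬RMLt A A := by
  simp [RMLt]

theorem RMLt.trans (h : RMLt A B) (h' : RMLt B C) : RMLt A C := by
  rcases h with h | ⟨h, h1⟩ <;> rcases h' with h' | ⟨h', h1'⟩
  · exact Or.inl (h'.trans h)
  · exact Or.inl (h' ▸ h)
  · exact Or.inl (h ▸ h')
  · exact Or.inr ⟨h.trans h', h1.trans h1'⟩

theorem RMLt.trichotomous (A B : Finset (Fin m)) : RMLt A B ∨ A = B ∨ RMLt B A := by
  rcases lt_trichotomy A.card B.card with h | h | h
  · exact Or.inr (Or.inr (Or.inl h))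
  · rcases lt_trichotomy (toColex A) (toColex B) with h1 | h1 | h1
    · exact Or.inl (Or.inr ⟨h, h1⟩)
    · exact Or.inr (Or.inl (toColex_inj.1 h1))
    · exact Or.inr (Or.inr (Or.inr ⟨h.symm, h1⟩))
  · exact Or.inl (Or.inl h)

theorem card_firstSet {i : ℕ} (hi : i ≤ m) : (firstSet m i).card = i := by
  rw [firstSet, Fin.card_filter_val_lt]
  omega

theorem card_lastSet {i : ℕ} (hi : i ≤ m) : (lastSet m i).card = i := by
  have h : lastSet m i = (firstSet m (m - i))ᶜ := by
    ext k; simp [lastSet, firstSet]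
  rw [h, Finset.card_compl, card_firstSet (by omega), Fintype.card_fin]
  omega

/-- Any element of B outside the initial segment exceeds everything in the segment, so the segment
is the colex minimum of its size. -/
theorem not_toColex_lt_firstSet {i : ℕ} (hi : i ≤ m) (hB : B.card = i) :
    ¬toColex B < toColex (firstSet m i) := by
  rw [not_lt, Finset.Colex.toColex_le_toColex]
  intro a ha haB
  have h : ¬B ⊆ firstSet m i := fun h =>
    haB ((Finset.eq_of_subset_of_card_le h (by rw [card_firstSet hi, hB])) ▸ ha)
  obtain ⟨b, hb, hbn⟩ := Finset.not_subset.1 h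
  refine ⟨b, hb, hbn, ?_⟩
  simp only [firstSet, Finset.mem_filter, Finset.mem_univ, true_and] at ha hbn
  exact Fin.le_def.2 (by omega)

theorem toColex_lt_lastSet {i : ℕ} (hi : i ≤ m) (hB : B.card = i) (hne : B ≠ lastSet m i) :
    toColex B < toColex (lastSet m i) := by
  rw [Finset.Colex.toColex_lt_toColex]
  refine ⟨hne, fun a ha haL => ?_⟩
  have h : ¬lastSet m i ⊆ B := fun h =>
    hne (Finset.eq_of_subset_of_card_le h (by rw [card_lastSet hi, hB])).symm
  obtain ⟨b, hb, hbn⟩ := Finset.not_subset.1 h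
  refine ⟨b, hb, hbn, ?_⟩
  simp only [lastSet, Finset.mem_filter, Finset.mem_univ, true_and] at haL hb
  exact Fin.le_def.2 (by omega)

theorem lift_firstSet {i : ℕ} (hi : i ≤ m) : lift (firstSet m i) = firstSet (m + 1) i := by
  ext k
  refine Fin.lastCases ?_ (fun k => ?_) k
  · simp [lift, firstSet, Fin.castSucc_ne_last, hi]
  · simp [lift, firstSet]

theorem liftInsert_lastSet (m i : ℕ) : liftInsert (lastSet m i) = lastSet (m + 1) (i + 1) := by
  ext k
  refine Fin.lastCases ?_ (fun k => ?_) k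
  · simp [last_mem_liftInsert, lastSet]
  · simp [liftInsert, lift, lastSet, ← add_assoc]

end Order

/-! ### The law of the sample -/

section Law

variable {𝒴 : Type*} [Fintype 𝒴] (W : BMSChannel 𝒴)

theorem law_nonneg (m : ℕ) (ω : Sample m 𝒴) : 0 ≤ law W m ω :=
  mul_nonneg (by positivity) (Finset.prod_nonneg fun _ _ => W.nonneg _ _)

theorem sum_wordProb {ι : Type*} [Fintype ι] [DecidableEq ι] (x : ι → ZMod 2) :
    ∑ y, W.wordProb x y = 1 := by
  simp only [BMSChannel.wordProb]
  rw [← Fintype.prod_sum]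
  simp [W.sum_eq_one]

/-- Sums against the law of `(U, Y)`, expressed in terms of `(X, Y)`. -/
theorem sum_law_mul (m : ℕ) (f : (Cube m → ZMod 2) → (Cube m → 𝒴) → ℝ) :
    ∑ ω, law W m ω * f (encode ω.1) ω.2 =
      (1 / 2) ^ 2 ^ m * ∑ x : Cube m → ZMod 2, ∑ y, W.wordProb x y * f x y := by
  rw [← encode_bijective.sum_comp, Fintype.sum_prod_type, Finset.mul_sum]
  simp only [law, Finset.mul_sum, mul_assoc]

theorem sum_law (m : ℕ) : ∑ ω, law W m ω = 1 := by
  have h := sum_law_mul W m fun _ _ => 1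
  simp only [mul_one, sum_wordProb] at h
  rw [h]
  simp

end Law

/-- Total mass one rules out an empty sample space; data processing needs a point to extend the
coarsening map. -/
theorem nonempty_sample {𝒴 : Type*} [Fintype 𝒴] (W : BMSChannel 𝒴) (m : ℕ) : Nonempty (Sample m 𝒴) := by
  by_contra h
  rw [not_nonempty_iff] at h
  simpa using sum_law W m

/-! ### One step of polarization -/

section Polarization

variable {𝒴 : Type*} [Fintype 𝒴] (W : BMSChannel 𝒴) {m : ℕ}

/-- The channel outputs together with the bits indexed by `D`. -/
def observe {m : ℕ} (D : Set (Finset (Fin m))) (ω : Sample m 𝒴) :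
    (Cube m → 𝒴) × ({B // B ∈ D} → ZMod 2) :=
  (ω.2, fun B => ω.1 B)

theorem observe_eq_iff {𝒴 : Type*} {D : Set (Finset (Fin m))} {ω ω' : Sample m 𝒴} :
    observe D ω = observe D ω' ↔ ω.2 = ω'.2 ∧ ∀ B ∈ D, ω.1 B = ω'.1 B := by
  simp [observe, funext_iff]

open Classical in
/-- The Bhattacharyya parameter of `U_A` given the output and all `U_B` with `B < A`. -/
noncomputable def rmBhatt (A : Finset (Fin m)) : ℝ :=
  bhatt (law W m) (fun ω => ω.1 A) (observe {B | RMLt B A})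

open Classical in
/-- The bias of `U_A` given the output and all `U_B` with `B < A`. -/
noncomputable def rmBias (A : Finset (Fin m)) : ℝ :=
  bias (law W m) (fun ω => ω.1 A) (observe {B | RMLt B A})

theorem rmBhatt_nonneg (A : Finset (Fin m)) : 0 ≤ rmBhatt W A := by
  classical exact bhatt_nonneg _ _ _

theorem rmBias_nonneg (A : Finset (Fin m)) : 0 ≤ rmBias W A := by
  classical exact bias_nonneg _ _ _

theorem rmBias_le_one (A : Finset (Fin m)) : rmBias W A ≤ 1 := by
  classical exact bias_le_one (law_nonneg W m) (sum_law W m) _ _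

theorem rmBhatt_sq_add_rmBias_sq_le (A : Finset (Fin m)) :
    rmBhatt W A ^ 2 + rmBias W A ^ 2 ≤ 1 := by
  classical exact bhatt_sq_add_bias_sq_le (law_nonneg W m) (sum_law W m) _ _

theorem H_le_one (A : Finset (Fin m)) : H W m A ≤ 1 := by
  classical exact condEntropy_bit_le_one (law_nonneg W m) (sum_law W m) _ _

theorem one_sub_rmBias_le_H (A : Finset (Fin m)) : 1 - rmBias W A ≤ H W m A := by
  classical exact one_sub_bias_le_condEntropy (law_nonneg W m) (sum_law W m) _ _

theorem H_nonneg (A : Finset (Fin m)) : 0 ≤ H W m A :=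
  (sub_nonneg.2 (rmBias_le_one W A)).trans (one_sub_rmBias_le_H W A)

theorem H_le_rmBhatt (A : Finset (Fin m)) : H W m A ≤ 2 / Real.log 2 * rmBhatt W A := by
  classical exact condEntropy_le_bhatt (law_nonneg W m) _ _

/-- The two halves of a sample under the Plotkin decomposition. -/
def split (ω : Sample (m + 1) 𝒴) : Sample m 𝒴 × Sample m 𝒴 :=
  ((fun B => ω.1 (lift B), fun z => ω.2 (Fin.snoc z 0 : Cube (m + 1))),
    (fun B => ω.1 (lift B) + ω.1 (liftInsert B), fun z => ω.2 (Fin.snoc z 1 : Cube (m + 1))))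

theorem split_bijective : Function.Bijective (split : Sample (m + 1) 𝒴 → _) := by
  classical
  rw [Fintype.bijective_iff_injective_and_card]
  constructor
  · rintro ⟨u, y⟩ ⟨u', y'⟩ h
    simp only [split, Prod.mk.injEq, funext_iff] at h
    obtain ⟨⟨h1, h2⟩, h3, h4⟩ := h
    refine Prod.ext (funext fun C => ?_) (funext fun z => ?_)
    · obtain ⟨B, rfl⟩ | ⟨B, rfl⟩ := eq_lift_or_eq_liftInsert C
      · exact h1 B
      · have := h3 B
        rw [h1 B] at this
        exact add_left_cancel this
    · refine Fin.snocCases (fun z b => ?_) z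
      have hb : b = 0 ∨ b = 1 := by clear * -; revert b; decide
      rcases hb with rfl | rfl
      · exact h2 z
      · exact h4 z
  · simp only [Fintype.card_prod, Fintype.card_fun, Fintype.card_finset, Fintype.card_fin,
      ZMod.card, pow_succ]
    ring

/-- By linearity the second half of the word encodes the sums of the two families of bits, and the
channel uses on the two halves are independent. -/
theorem law_succ (ω : Sample (m + 1) 𝒴) : law W (m + 1) ω = square (law W m) (split ω) := by
  have h : encode (fun B => ω.1 (lift B) + ω.1 (liftInsert B)) =
      encode (fun B => ω.1 (lift B)) + encode fun B => ω.1 (liftInsert B) := encode_add _ _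
  simp only [law, square, split, BMSChannel.wordProb, prod_cube_succ, encode_snoc, h,
    zero_mul, one_mul, add_zero, Pi.add_apply]
  ring

theorem sum_law_succ_mul (f : Sample m 𝒴 × Sample m 𝒴 → ℝ) :
    ∑ ω, law W (m + 1) ω * f (split ω) = ∑ ω, square (law W m) ω * f ω := by
  simp only [law_succ]
  exact split_bijective.sum_comp fun ω => square (law W m) ω * f ω

/-- The bits without the element `m + 1` undergo the plus transform. -/
theorem rmBhatt_lift_le (A : Finset (Fin m)) : rmBhatt W (lift A) ≤ rmBhatt W A ^ 2 := by
  classical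
  have := nonempty_sample W m
  rw [rmBhatt, rmBhatt, ← bhatt_plus (law_nonneg W m)]
  refine bhatt_le split (law_nonneg W _) (sum_law_succ_mul W) (fun _ => rfl) fun ω ω' h => ?_
  rw [observe_eq_iff] at h
  obtain ⟨hy, hu⟩ := h
  -- For B < A both `lift B` and `liftInsert B` come earlier, which gives both halves; `liftInsert
  -- A` also comes earlier, and its bit is the sum revealed by the plus transform.
  have h1 : ∀ B, RMLt B A → ω.1 (lift B) = ω'.1 (lift B) := fun B hB => hu _ hB.lift
  have h2 : ∀ B : Finset (Fin m), A.card ≤ B.card → ω.1 (liftInsert B) = ω'.1 (liftInsert B) :=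
    fun B hB => hu _ (rmLt_liftInsert_lift hB)
  refine Prod.ext (Prod.ext ?_ ?_) ?_
  · exact observe_eq_iff.2 ⟨by simp only [split, hy], h1⟩
  · refine observe_eq_iff.2 ⟨by simp only [split, hy], fun B hB => ?_⟩
    simp only [split, h1 B hB, h2 B (RMLt.card_le hB)]
  · simp only [split, ← add_assoc, CharTwo.add_self_eq_zero, zero_add, h2 A le_rfl]

/-- The bits with the element `m + 1` undergo the minus transform. -/
theorem rmBias_liftInsert_le (A : Finset (Fin m)) :
    rmBias W (liftInsert A) ≤ rmBias W A ^ 2 := by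
  classical
  have := nonempty_sample W (m + 1)
  rw [rmBias, rmBias, ← bias_minus]
  have hinv := Function.surjInv_eq (split_bijective (m := m) (𝒴 := 𝒴)).2
  -- The comparison now runs from pairs to samples: the pair of observations determines everything
  -- that precedes `liftInsert A`.
  refine bias_le (Function.surjInv split_bijective.2) (fun f => ?_) (fun ω => ?_) fun ω ω' h => ?_
  · have h := sum_law_succ_mul W fun ω => f (Function.surjInv split_bijective.2 ω)
    rw [← h]
    simp only [Function.leftInverse_surjInv split_bijective _]
  · conv_lhs => rw [← hinv ω]
    simp only [split, ← add_assoc, CharTwo.add_self_eq_zero, zero_add]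
  · rw [← hinv ω, ← hinv ω'] at h
    generalize Function.surjInv split_bijective.2 ω = ω at h ⊢
    generalize Function.surjInv split_bijective.2 ω' = ω' at h ⊢
    rw [Prod.mk.injEq, observe_eq_iff, observe_eq_iff] at h
    obtain ⟨⟨hy, hu⟩, hy', hu'⟩ := h
    simp only [split, funext_iff] at hy hu hy' hu'
    refine observe_eq_iff.2 ⟨funext fun z => ?_, fun C hC => ?_⟩
    · refine Fin.snocCases (fun z b => ?_) z
      have hb : b = 0 ∨ b = 1 := by clear * -; revert b; decide
      rcases hb with rfl | rfl
      · exact hy z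
      · exact hy' z
    · obtain ⟨B, rfl⟩ | ⟨B, rfl⟩ := eq_lift_or_eq_liftInsert C
      · exact hu B (rmLt_of_lift_liftInsert hC)
      · have hB : RMLt B A := rmLt_liftInsert_iff.1 hC
        have := hu' B hB
        rw [hu B hB] at this
        exact add_left_cancel this

/-- Forgetting the second half leaves exactly the observation for A in dimension m. -/
theorem rmBias_le_rmBias_lift (A : Finset (Fin m)) : rmBias W A ≤ rmBias W (lift A) := by
  classical
  have := nonempty_sample W m
  refine bias_le (fun ω => (split ω).1) (fun f => ?_) (fun _ => rfl) fun ω ω' h => ?_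
  · rw [sum_law_succ_mul W fun ω => f ω.1, sum_square_mul_fst (sum_law W m)]
  · rw [observe_eq_iff] at h ⊢
    exact ⟨by simp only [split, h.1], fun B hB => h.2 _ (RMLt.lift hB)⟩

/-! ### Permutations of the coordinates -/

/-- The action of a permutation of `{1, …, m}` on samples. -/
def relabel (σ : Equiv.Perm (Fin m)) (ω : Sample m 𝒴) : Sample m 𝒴 :=
  (fun B => ω.1 (B.map σ.toEmbedding), fun z => ω.2 (z ∘ σ.symm))

theorem relabel_bijective (σ : Equiv.Perm (Fin m)) :
    Function.Bijective (relabel σ : Sample m 𝒴 → _) := by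
  classical
  rw [← Finite.injective_iff_bijective]
  rintro ⟨u, y⟩ ⟨u', y'⟩ h
  simp only [relabel, Prod.mk.injEq, funext_iff] at h
  refine Prod.ext (funext fun C => ?_) (funext fun z => ?_)
  · simpa [Finset.map_map] using h.1 (C.map σ.symm.toEmbedding)
  · simpa [Function.comp_assoc] using h.2 (z ∘ σ)

theorem encode_relabel (σ : Equiv.Perm (Fin m)) (u : Finset (Fin m) → ZMod 2) (z : Cube m) :
    encode (fun B => u (B.map σ.toEmbedding)) (z ∘ σ) = encode u z := by
  rw [encode_apply, encode_apply, ← (Equiv.finsetCongr σ).sum_comp fun A => u A * evalVec A z]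
  simp [evalVec]

theorem law_relabel (σ : Equiv.Perm (Fin m)) (ω : Sample m 𝒴) :
    law W m (relabel σ ω) = law W m ω := by
  rw [law, law, BMSChannel.wordProb, BMSChannel.wordProb,
    ← (σ.symm.arrowCongr (Equiv.refl (ZMod 2))).prod_comp]
  congr 1
  refine Finset.prod_congr rfl fun z _ => ?_
  have h : (σ.symm.arrowCongr (Equiv.refl (ZMod 2))) z = z ∘ σ := by ext; simp
  rw [h]
  simp only [relabel, encode_relabel, Function.comp_assoc, Equiv.self_comp_symm,
    Function.comp_id]

theorem sum_law_relabel_mul (σ : Equiv.Perm (Fin m)) (f : Sample m 𝒴 → ℝ) :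
    ∑ ω, law W m ω * f (relabel σ ω) = ∑ ω, law W m ω * f ω := by
  rw [← (relabel_bijective σ).sum_comp fun ω => law W m ω * f ω]
  simp only [law_relabel]

theorem exists_perm_map_eq {A B : Finset (Fin m)} (h : A.card = B.card) :
    ∃ σ : Equiv.Perm (Fin m), A.map σ.toEmbedding = B := by
  let e : {x // x ∈ A} ≃ {x // x ∈ B} := Finset.equivOfCardEq h
  refine ⟨e.extendSubtype, Finset.eq_of_subset_of_card_le (fun x hx => ?_) (by simp [h])⟩
  obtain ⟨y, hy, rfl⟩ := Finset.mem_map.1 hx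
  exact e.extendSubtype_mem y hy

/-- The set `{1, …, i}` has the largest Bhattacharyya parameter among the sets of size `i`. -/
theorem rmBhatt_le_firstSet {A : Finset (Fin m)} {i : ℕ} (hA : A.card = i) :
    rmBhatt W A ≤ rmBhatt W (firstSet m i) := by
  classical
  have hi : i ≤ m := by simpa [hA] using A.card_le_univ
  have := nonempty_sample W m
  obtain ⟨σ, hσ⟩ := exists_perm_map_eq ((card_firstSet hi).trans hA.symm)
  refine bhatt_le (relabel σ) (law_nonneg W m) (sum_law_relabel_mul W σ)
    (fun ω => by simp only [relabel, hσ]) fun ω ω' h => ?_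
  rw [observe_eq_iff] at h ⊢
  refine ⟨by simp only [relabel, h.1], fun B hB => h.2 _ ?_⟩
  rcases hB with hB | hB
  · exact Or.inl (by rw [card_firstSet hi] at hB; rwa [Finset.card_map, hA])
  -- No set of size i precedes {1,…,i}; the strictly larger sets are merely permuted among
  -- themselves.
  · exact absurd hB.2 (not_toColex_lt_firstSet hi (hB.1.trans (card_firstSet hi)))

/-- The set `{m - i + 1, …, m}` has the largest bias among the sets of size `i`. -/
theorem rmBias_le_lastSet {A : Finset (Fin m)} {i : ℕ} (hA : A.card = i) :
    rmBias W A ≤ rmBias W (lastSet m i) := by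
  classical
  have hi : i ≤ m := by simpa [hA] using A.card_le_univ
  have := nonempty_sample W m
  obtain ⟨σ, hσ⟩ := exists_perm_map_eq (hA.trans (card_lastSet hi).symm)
  refine bias_le (relabel σ) (sum_law_relabel_mul W σ)
    (fun ω => by simp only [relabel, hσ]) fun ω ω' h => ?_
  rw [observe_eq_iff] at h ⊢
  refine ⟨by simp only [relabel, h.1], fun B hB => h.2 _ ?_⟩
  rcases hB with hB | hB
  · exact Or.inl (by rwa [Finset.card_map, card_lastSet hi, ← hA])
  -- All other sets of size i precede {m-i+1,…,m}, so it suffices that the image of B is not that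
  -- set.
  · have hc : (B.map σ.toEmbedding).card = i := by rw [Finset.card_map, hB.1, hA]
    refine Or.inr ⟨hc.trans (card_lastSet hi).symm, toColex_lt_lastSet hi hc fun h => ?_⟩
    rw [← hσ, Finset.map_inj] at h
    exact absurd hB.2 (h ▸ lt_irrefl _)

/-! ### Iteration -/

theorem rmBhatt_firstSet_add_le {i : ℕ} (hi : i ≤ m) (k : ℕ) :
    rmBhatt W (firstSet (m + k) i) ≤ rmBhatt W (firstSet m i) ^ 2 ^ k := by
  induction k with
  | zero => simp
  | succ k ih =>
    have h := rmBhatt_lift_le W (firstSet (m + k) i)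
    rw [lift_firstSet (by omega)] at h
    refine h.trans ?_
    rw [pow_succ 2, pow_mul]
    exact pow_le_pow_left₀ (rmBhatt_nonneg W _) ih 2

theorem rmBias_lastSet_add_le (i k : ℕ) :
    rmBias W (lastSet (m + k) (i + k)) ≤ rmBias W (lastSet m i) ^ 2 ^ k := by
  induction k with
  | zero => simp
  | succ k ih =>
    have h := rmBias_liftInsert_le W (lastSet (m + k) (i + k))
    rw [liftInsert_lastSet] at h
    refine h.trans ?_
    rw [pow_succ 2, pow_mul]
    exact pow_le_pow_left₀ (rmBias_nonneg W _) ih 2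

/-- Both sides are compared with the set of size i in one dimension less: inserting the new element
squares its bias, lifting does not lower it. -/
theorem rmBias_lastSet_succ_le {i : ℕ} (hi : i + 1 ≤ m) :
    rmBias W (lastSet m (i + 1)) ≤ rmBias W (lastSet m i) := by
  obtain ⟨m, rfl⟩ : ∃ n, m = n + 1 := ⟨m - 1, by omega⟩
  have h1 := rmBias_lastSet_add_le W (m := m) i 1
  have h2 := rmBias_le_rmBias_lift W (lastSet m i)
  have h3 := rmBias_le_lastSet W (A := lift (lastSet m i)) (i := i)
    (by rw [card_lift, card_lastSet (by omega)])
  have h4 := rmBias_nonneg W (lastSet m i)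
  have h5 := rmBias_le_one W (lastSet m i)
  simp only [pow_one] at h1
  nlinarith

theorem rmBias_lastSet_anti {i j : ℕ} (hij : i ≤ j) (hj : j ≤ m) :
    rmBias W (lastSet m j) ≤ rmBias W (lastSet m i) := by
  induction j, hij using Nat.le_induction with
  | base => exact le_rfl
  | succ j _ ih => exact (rmBias_lastSet_succ_le W hj).trans (ih (by omega))

/-- A layer with a small Bhattacharyya parameter is almost noiseless after `k` more steps. -/
theorem H_le_of_rmBhatt_le {M k : ℕ} (hM : M = m + k) {A : Finset (Fin M)} {z : ℝ}
    (hA : A.card ≤ m) (hz : rmBhatt W (firstSet m A.card) ≤ z) :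
    H W M A ≤ 2 / Real.log 2 * z ^ 2 ^ k := by
  subst hM
  refine (H_le_rmBhatt W A).trans ?_
  have := Real.log_pos one_lt_two
  gcongr
  exact ((rmBhatt_le_firstSet W rfl).trans (rmBhatt_firstSet_add_le W hA k)).trans
    (pow_le_pow_left₀ (rmBhatt_nonneg W _) hz _)

/-- All layers above a layer with a small bias are almost pure noise after `k` more steps. -/
theorem one_sub_le_H_of_rmBias_le {M k : ℕ} (hM : M = m + k) {A : Finset (Fin M)} {z : ℝ}
    {j : ℕ} (hA : j + k ≤ A.card) (hz : rmBias W (lastSet m j) ≤ z) :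
    1 - z ^ 2 ^ k ≤ H W M A := by
  subst hM
  refine le_trans ?_ (one_sub_rmBias_le_H W A)
  obtain ⟨i, hi⟩ : ∃ i, A.card = i + k := ⟨A.card - k, by omega⟩
  have hm : A.card ≤ m + k := by simpa using A.card_le_univ
  have h1 := (rmBias_le_lastSet W hi).trans (rmBias_lastSet_add_le W i k)
  have h2 := (rmBias_lastSet_anti W (i := j) (j := i) (by omega) (by omega)).trans hz
  have h3 := pow_le_pow_left₀ (rmBias_nonneg W _) h2 (2 ^ k)
  linarith

/-- Entropy below 1 forces a positive bias, which in turn keeps the Bhattacharyya parameter below 1.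
-/
theorem rmBhatt_le_of_H_le {A : Finset (Fin m)} {t : ℝ} (ht : t ≤ 1) (h : H W m A ≤ t) :
    rmBhatt W A ≤ √(1 - (1 - t) ^ 2) := by
  have h1 := one_sub_rmBias_le_H W A
  have h2 := rmBhatt_sq_add_rmBias_sq_le W A
  refine Real.le_sqrt_of_sq_le ?_
  nlinarith

/-- Positive entropy forces a positive Bhattacharyya parameter, which keeps the bias below 1. -/
theorem rmBias_le_of_le_H {A : Finset (Fin m)} {s : ℝ} (hs : 0 ≤ s) (h : s ≤ H W m A) :
    rmBias W A ≤ √(1 - (s * Real.log 2 / 2) ^ 2) := by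
  have h1 := h.trans (H_le_rmBhatt W A)
  have h2 := rmBhatt_sq_add_rmBias_sq_le W A
  have hl := Real.log_pos one_lt_two
  have h3 : s * Real.log 2 / 2 ≤ rmBhatt W A := by
    rw [div_mul_eq_mul_div, le_div_iff₀ hl] at h1
    linarith
  have h4 := pow_le_pow_left₀ (by positivity) h3 2
  refine Real.le_sqrt_of_sq_le ?_
  linarith

end Polarization
/-! ### The chain rule -/

section ChainRule

variable {𝒴 : Type*} [Fintype 𝒴] (W : BMSChannel 𝒴) (m : ℕ)

/-- The joint entropy of the channel outputs and of the bits indexed by `D`. -/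
noncomputable def jointEntropy (D : Set (Finset (Fin m))) : ℝ :=
  -∑ ω, law W m ω *
    Real.logb 2 (prob (law W m) {ω' | ω'.2 = ω.2 ∧ ∀ B ∈ D, ω'.1 B = ω.1 B})

theorem H_eq_jointEntropy_sub (A : Finset (Fin m)) :
    H W m A = jointEntropy W m {B | RMLt B A ∨ B = A} - jointEntropy W m {B | RMLt B A} := by
  classical
  refine (condEntropy_eq (law_nonneg W m) (fun ω => ω.1 A) (observe {B | RMLt B A})).trans ?_
  have h : ∀ ω ω' : Sample m 𝒴, (ω'.1 A = ω.1 A ∧ ω'.2 = ω.2 ∧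
      ∀ B ∈ {B | RMLt B A}, ω'.1 B = ω.1 B) ↔
      ω'.2 = ω.2 ∧ ∀ B ∈ {B | RMLt B A ∨ B = A}, ω'.1 B = ω.1 B := by
    intro ω ω'
    simp only [Set.mem_ofPred_eq, or_imp, forall_and, forall_eq]
    tauto
  simp only [observe_eq_iff, h, jointEntropy]

/-- The chain rule telescopes: a minimal set A outside the down-closed D satisfies D = {B < A}, so
adding A to D removes exactly one summand. -/
theorem sum_H_eq_jointEntropy_sub (D : Set (Finset (Fin m))) [DecidablePred (· ∈ D)]
    (hD : ∀ A B, B ∈ D → RMLt A B → A ∈ D) :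
    ∑ A with A ∉ D, H W m A = jointEntropy W m Set.univ - jointEntropy W m D := by
  classical
  induction hn : (Finset.univ.filter fun A => A ∉ D).card generalizing D with
  | zero =>
    rw [Finset.card_eq_zero] at hn
    have : D = Set.univ := by
      ext A
      simpa using (Finset.filter_eq_empty_iff.1 hn) (Finset.mem_univ A)
    rw [hn, this, Finset.sum_empty, sub_self]
  | succ n ih =>
    have hwf : WellFounded (RMLt (m := m)) := by
      have : IsTrans _ (RMLt (m := m)) := ⟨fun _ _ _ => RMLt.trans⟩
      have : Std.Irrefl (RMLt (m := m)) := ⟨RMLt.irrefl⟩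
      exact Finite.wellFounded_of_trans_of_irrefl _
    have hne : Dᶜ.Nonempty := by
      obtain ⟨A, hA⟩ := Finset.card_pos.1 (by rw [hn]; exact Nat.succ_pos n)
      exact ⟨A, (Finset.mem_filter.1 hA).2⟩
    obtain ⟨A, hA, hmin⟩ := hwf.has_min Dᶜ hne
    have hDA : D = {B | RMLt B A} := by
      ext B
      constructor
      · intro hB
        rcases RMLt.trichotomous A B with h | rfl | h
        · exact absurd (hD _ _ hB h) hA
        · exact absurd hB hA
        · exact h
      · intro hB
        by_contra h
        exact hmin B h hB
    have hDA' : insert A D = {B | RMLt B A ∨ B = A} := by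
      ext B
      simp [hDA, or_comm]
    have hfil : (Finset.univ.filter fun B => B ∉ D) =
        insert A (Finset.univ.filter fun B => B ∉ insert A D) := by
      ext B
      by_cases h : B = A
      · subst h; simpa using hA
      · simp [h]
    have hnot : A ∉ Finset.univ.filter fun B => B ∉ insert A D := by simp
    rw [hfil, Finset.card_insert_of_notMem hnot] at hn
    have := ih (insert A D) (fun B C hC hBC => ?_) (by simpa using hn)
    · rw [hfil, Finset.sum_insert hnot, this, H_eq_jointEntropy_sub, hDA', ← hDA]
      ring
    · rcases hC with rfl | hC
      · exact Or.inr (hDA ▸ hBC)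
      · exact Or.inr (hD _ _ hC hBC)

theorem condEntropy_observe (D : Set (Finset (Fin m))) [Fintype {B // B ∈ D}]
    [DecidableEq {B // B ∈ D}] :
    condEntropy (law W m) (fun ω => ω.1) (observe D) =
      jointEntropy W m Set.univ - jointEntropy W m D := by
  rw [condEntropy_eq (law_nonneg W m)]
  have h : ∀ ω ω' : Sample m 𝒴, (ω'.1 = ω.1 ∧ ω'.2 = ω.2 ∧ ∀ B ∈ D, ω'.1 B = ω.1 B) ↔
      ω'.2 = ω.2 ∧ ∀ B ∈ Set.univ, ω'.1 B = ω.1 B := by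
    intro ω ω'
    exact ⟨fun h => ⟨h.2.1, fun B _ => congrFun h.1 B⟩,
      fun h => ⟨funext fun B => h.2 B trivial, h.1, fun B _ => h.2 B trivial⟩⟩
  simp only [observe_eq_iff, h, jointEntropy]

end ChainRule

/-! ### Capacity -/

section Capacity

variable {𝒴 : Type*} [Fintype 𝒴] (W : BMSChannel 𝒴)

/-- The output law for a uniform input. -/
noncomputable def outputLaw (y : 𝒴) : ℝ := (W.trans 0 y + W.trans 1 y) / 2

theorem outputLaw_nonneg (y : 𝒴) : 0 ≤ outputLaw W y :=
  div_nonneg (add_nonneg (W.nonneg _ _) (W.nonneg _ _)) zero_le_two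

theorem trans_le_two_mul_outputLaw (x : ZMod 2) (y : 𝒴) : W.trans x y ≤ 2 * outputLaw W y := by
  have h0 := W.nonneg 0 y
  have h1 := W.nonneg 1 y
  have hx : x = 0 ∨ x = 1 := by revert x; decide
  rcases hx with rfl | rfl <;> rw [outputLaw] <;> linarith

theorem outputLaw_pos {x : ZMod 2} {y : 𝒴} (h : 0 < W.trans x y) : 0 < outputLaw W y := by
  have := trans_le_two_mul_outputLaw W x y
  linarith

/-- The divergence of the output law for the input `x` from that for a uniform input. -/
noncomputable def inputDivergence (x : ZMod 2) : ℝ :=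
  ∑ y, W.trans x y * Real.logb 2 (W.trans x y / outputLaw W y)

/-- The channel symmetry exchanges the two inputs and fixes the output law. -/
theorem inputDivergence_one : inputDivergence W 1 = inputDivergence W 0 := by
  obtain ⟨π, hπ, h⟩ := W.symmetric
  have h' : ∀ y, W.trans 1 (π y) = W.trans 0 y := fun y => by rw [h, hπ]
  rw [inputDivergence, ← Equiv.sum_comp π]
  refine Finset.sum_congr rfl fun y _ => ?_
  have : outputLaw W (π y) = outputLaw W y := by
    rw [outputLaw, outputLaw, h', ← h, add_comm]
  rw [this, h']

theorem inputDivergence_eq (x : ZMod 2) : inputDivergence W x = inputDivergence W 0 := by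
  have hx : x = 0 ∨ x = 1 := by revert x; decide
  rcases hx with rfl | rfl
  · rfl
  · exact inputDivergence_one W

theorem mutualInfo_uniform : W.mutualInfo (fun _ => 1 / 2) = inputDivergence W 0 := by
  have h : ∀ y, ∑ x, 1 / 2 * W.trans x y = outputLaw W y := fun y => by
    rw [sum_zmod_two, outputLaw]; ring
  rw [BMSChannel.mutualInfo, sum_zmod_two]
  simp only [h, mul_assoc]
  rw [← Finset.mul_sum, ← Finset.mul_sum, ← inputDivergence, ← inputDivergence,
    inputDivergence_one]
  ring

/-- The mutual information is the average divergence from the uniform output law Q, which is the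
same for both inputs, minus the divergence of the actual output law P from Q. The latter is
nonnegative by log x ≤ x - 1 at x = Q/P. -/
theorem mutualInfo_le {p : ZMod 2 → ℝ} (hp : p ∈ stdSimplex ℝ (ZMod 2)) :
    W.mutualInfo p ≤ inputDivergence W 0 := by
  obtain ⟨hp0, hp1⟩ := hp
  have hl := Real.log_pos one_lt_two
  set P : 𝒴 → ℝ := fun y => ∑ x, p x * W.trans x y with hP
  have hPle : ∀ x y, p x * W.trans x y ≤ P y := fun x y =>
    Finset.single_le_sum (f := fun x => p x * W.trans x y)
      (fun x _ => mul_nonneg (hp0 x) (W.nonneg x y)) (Finset.mem_univ x)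
  have h1 : inputDivergence W 0 =
      ∑ x, ∑ y, p x * W.trans x y * Real.logb 2 (W.trans x y / outputLaw W y) := by
    have h : ∀ x, ∑ y, W.trans x y * Real.logb 2 (W.trans x y / outputLaw W y) =
        inputDivergence W 0 := inputDivergence_eq W
    simp only [mul_assoc, ← Finset.mul_sum, h, ← Finset.sum_mul, hp1, one_mul]
  have h2 : ∀ x y, p x * W.trans x y * Real.logb 2 (W.trans x y / P y) ≤
      p x * W.trans x y * Real.logb 2 (W.trans x y / outputLaw W y) +
        p x * W.trans x y * ((outputLaw W y / P y - 1) / Real.log 2) := by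
    intro x y
    rcases (mul_nonneg (hp0 x) (W.nonneg x y)).eq_or_lt with h | h
    · simp [← h]
    have hW : 0 < W.trans x y := pos_of_mul_pos_right h (hp0 x)
    have hPy : 0 < P y := h.trans_le (hPle x y)
    have hQ := outputLaw_pos W hW
    rw [← mul_add]
    refine mul_le_mul_of_nonneg_left ?_ h.le
    rw [Real.logb_div hW.ne' hPy.ne', Real.logb_div hW.ne' hQ.ne']
    have h3 := Real.log_le_sub_one_of_pos (div_pos hQ hPy)
    rw [Real.log_div hQ.ne' hPy.ne'] at h3
    have h4 : Real.logb 2 (outputLaw W y) - Real.logb 2 (P y) ≤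
        (outputLaw W y / P y - 1) / Real.log 2 := by
      rw [Real.logb, Real.logb, ← sub_div]
      gcongr
    linarith
  have h3 : ∑ x, ∑ y, p x * W.trans x y * ((outputLaw W y / P y - 1) / Real.log 2) ≤ 0 := by
    rw [Finset.sum_comm]
    have h4 : ∀ y, ∑ x, p x * W.trans x y * ((outputLaw W y / P y - 1) / Real.log 2) ≤
        (outputLaw W y - P y) / Real.log 2 := by
      intro y
      rw [← Finset.sum_mul, ← mul_div_assoc]
      gcongr
      change P y * _ ≤ _
      by_cases h : P y = 0
      · simp [h, outputLaw_nonneg]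
      · rw [mul_sub, mul_div_cancel₀ _ h, mul_one]
    refine (Finset.sum_le_sum fun y _ => h4 y).trans ?_
    have hQ1 : ∑ y, outputLaw W y = 1 := by
      simp only [outputLaw, ← Finset.sum_div, Finset.sum_add_distrib, W.sum_eq_one]
      norm_num
    have hP1 : ∑ y, P y = 1 := by
      simp only [hP]
      rw [Finset.sum_comm]
      simp only [← Finset.mul_sum, W.sum_eq_one, mul_one, hp1]
    rw [← Finset.sum_div, Finset.sum_sub_distrib, hQ1, hP1]
    simp
  rw [h1]
  have h5 := Finset.sum_le_sum fun x (_ : x ∈ Finset.univ) =>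
    Finset.sum_le_sum fun y (_ : y ∈ Finset.univ) => h2 x y
  simp only [Finset.sum_add_distrib] at h5
  rw [BMSChannel.mutualInfo]
  linarith

theorem capacity_eq : W.capacity = inputDivergence W 0 := by
  refine IsGreatest.csSup_eq ⟨⟨fun _ => 1 / 2, ⟨fun _ => by norm_num, ?_⟩,
    mutualInfo_uniform W⟩, ?_⟩
  · rw [sum_zmod_two]; norm_num
  · rintro _ ⟨p, hp, rfl⟩
    exact mutualInfo_le W hp

/-- The marginal of one coordinate of a product law. -/
theorem sum_prod_mul_coord {ι S : Type*} [Fintype ι] [DecidableEq ι] [Fintype S] (p : ι → S → ℝ)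
    (hp : ∀ i, ∑ s, p i s = 1) (j : ι) (g : S → ℝ) :
    ∑ s : ι → S, (∏ i, p i (s i)) * g (s j) = ∑ b, p j b * g b := by
  have h : ∀ s : ι → S, (∏ i, p i (s i)) * g (s j) =
      ∏ i, p i (s i) * if i = j then g (s i) else 1 := by
    intro s
    rw [Finset.prod_mul_distrib]
    simp
  simp only [h]
  rw [← Fintype.prod_sum fun i b => p i b * if i = j then g b else 1,
    Finset.prod_eq_single j (fun i _ hi => by simp [hi, hp]) (by simp)]
  simp

/-- Every position of the transmitted word and of the output is a uniform use of the channel. -/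
theorem sum_law_mul_coord (m : ℕ) (z : Cube m) (f : ZMod 2 → 𝒴 → ℝ) :
    ∑ ω, law W m ω * f (encode ω.1 z) (ω.2 z) =
      ∑ x, 1 / 2 * ∑ y, W.trans x y * f x y := by
  rw [sum_law_mul W m fun x y => f (x z) (y z)]
  have h : ∀ x : Cube m → ZMod 2, ∑ y, W.wordProb x y * f (x z) (y z) =
      ∑ b, W.trans (x z) b * f (x z) b := fun x =>
    sum_prod_mul_coord (fun i => W.trans (x i)) (fun i => W.sum_eq_one _) z (f (x z))
  simp only [h]
  rw [← sum_prod_mul_coord (fun (_ : Cube m) (_ : ZMod 2) => (1 / 2 : ℝ))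
    (fun _ => by rw [sum_zmod_two]; norm_num) z fun a => ∑ b, W.trans a b * f a b]
  simp [Finset.mul_sum]

theorem prob_output_eq (m : ℕ) (y : Cube m → 𝒴) :
    prob (law W m) {ω | ω.2 = y} = ∏ z, outputLaw W (y z) := by
  classical
  have h : prob (law W m) {ω | ω.2 = y} = ∑ ω, law W m ω * if ω.2 = y then 1 else 0 := by
    rw [prob_eq_sum_mul]
    congr! 3
  rw [h, sum_law_mul W m fun _ y' => if y' = y then 1 else 0]
  simp only [mul_ite, mul_one, mul_zero, Finset.sum_ite_eq', Finset.mem_univ, if_true,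
    BMSChannel.wordProb]
  rw [← Fintype.prod_sum fun z x => W.trans x (y z)]
  simp only [sum_zmod_two, outputLaw, Finset.prod_div_distrib]
  simp [div_eq_inv_mul]

/-- For each sample the logarithm of the likelihood ratio splits over the coordinates; the factor
(1/2)^(2^m) gives one bit to each, and each then has mean 1 - C. -/
theorem jointEntropy_univ_sub_empty (m : ℕ) :
    jointEntropy W m Set.univ - jointEntropy W m ∅ = 2 ^ m * (1 - W.capacity) := by
  classical
  have h1 : ∀ ω : Sample m 𝒴, prob (law W m) {ω' | ω'.2 = ω.2 ∧ ∀ B ∈ Set.univ, ω'.1 B = ω.1 B} =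
      law W m ω := by
    intro ω
    have : {ω' : Sample m 𝒴 | ω'.2 = ω.2 ∧ ∀ B ∈ Set.univ, ω'.1 B = ω.1 B} = {ω} := by
      ext ω'
      simp [Prod.ext_iff, funext_iff, and_comm]
    rw [this]
    simp [prob]
  have h2 : ∀ ω : Sample m 𝒴,
      prob (law W m) {ω' | ω'.2 = ω.2 ∧ ∀ B ∈ (∅ : Set _), ω'.1 B = ω.1 B} =
      ∏ z, outputLaw W (ω.2 z) := by
    intro ω
    simp [← prob_output_eq]
  have h3 : ∀ ω : Sample m 𝒴, law W m ω * Real.logb 2 (∏ z, outputLaw W (ω.2 z)) -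
      law W m ω * Real.logb 2 (law W m ω) =
      ∑ z, law W m ω * (1 - Real.logb 2 (W.trans (encode ω.1 z) (ω.2 z) /
        outputLaw W (ω.2 z))) := by
    intro ω
    rcases (law_nonneg W m ω).eq_or_lt with h | h
    · simp [← h]
    have hW : ∀ z, 0 < W.trans (encode ω.1 z) (ω.2 z) := by
      intro z
      refine (W.nonneg _ _).lt_of_ne' fun h0 => h.ne' ?_
      rw [law, BMSChannel.wordProb, Finset.prod_eq_zero (Finset.mem_univ z) h0, mul_zero]
    have hQ : ∀ z, 0 < outputLaw W (ω.2 z) := fun z => outputLaw_pos W (hW z)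
    rw [← Finset.mul_sum, ← mul_sub]
    congr 1
    rw [Finset.sum_sub_distrib, Finset.sum_congr rfl fun z _ =>
      Real.logb_div (hW z).ne' (hQ z).ne', Finset.sum_sub_distrib, law, BMSChannel.wordProb,
      Real.logb_mul (by positivity) (Finset.prod_pos fun z _ => hW z).ne', Real.logb_pow,
      Real.logb_prod _ _ fun z _ => (hW z).ne', Real.logb_prod _ _ fun z _ => (hQ z).ne',
      one_div, Real.logb_inv, Real.logb_self_eq_one one_lt_two]
    simp
    ring
  have h4 : ∀ z : Cube m, ∑ ω, law W m ω * (1 - Real.logb 2 (W.trans (encode ω.1 z) (ω.2 z) /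
      outputLaw W (ω.2 z))) = 1 - W.capacity := by
    intro z
    rw [sum_law_mul_coord W m z fun x y => 1 - Real.logb 2 (W.trans x y / outputLaw W y)]
    have h : ∀ x, ∑ y, W.trans x y * Real.logb 2 (W.trans x y / outputLaw W y) =
        inputDivergence W 0 := inputDivergence_eq W
    simp only [mul_sub, mul_one, Finset.sum_sub_distrib, W.sum_eq_one, h, capacity_eq]
    rw [sum_zmod_two, sum_zmod_two]
    ring
  simp only [jointEntropy, h1, h2]
  rw [neg_sub_neg, ← Finset.sum_sub_distrib, Finset.sum_congr rfl fun ω _ => h3 ω,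
    Finset.sum_comm, Finset.sum_congr rfl fun z _ => h4 z]
  simp [mul_sub]

/-- The conditional entropies of all bits add up to `2 ^ m * (1 - C)`. -/
theorem sum_H (m : ℕ) : ∑ A, H W m A = 2 ^ m * (1 - W.capacity) := by
  have h := sum_H_eq_jointEntropy_sub W m ∅ (by simp)
  rw [jointEntropy_univ_sub_empty] at h
  simpa using h

end Capacity

/-! ### Decoding -/

section Decoding

variable {𝒴 : Type*} [Fintype 𝒴] (W : BMSChannel 𝒴)

theorem errorProb_nonneg {m : ℕ} (C : Submodule (ZMod 2) (Cube m → ZMod 2))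
    (dec : (Cube m → 𝒴) → Cube m → ZMod 2) : 0 ≤ errorProb W C dec := by
  refine div_nonneg (Finset.sum_nonneg fun c _ => Finset.sum_nonneg fun y _ => ?_)
    (Nat.cast_nonneg _)
  split_ifs
  · exact le_rfl
  · exact Finset.prod_nonneg fun _ _ => W.nonneg _ _

open Classical in
/-- By the symmetry of the channel, decoding a coset of a code is as easy as decoding the code. -/
theorem exists_decoder_of_coset {m : ℕ} (C : Submodule (ZMod 2) (Cube m → ZMod 2))
    (s : Cube m → ZMod 2) (d : (Cube m → 𝒴) → Cube m → ZMod 2) :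
    ∃ dec, errorProb W C dec =
      (∑ c : C, ∑ y, W.wordProb (s + (c : Cube m → ZMod 2)) y *
        if d y ≠ s + (c : Cube m → ZMod 2) then 1 else 0) / Nat.card C := by
  classical
  obtain ⟨π, hπ, h⟩ := W.symmetric
  -- Applying π to the outputs where s is 1 has the effect of adding s to the input word.
  let τ : (Cube m → 𝒴) → Cube m → 𝒴 := fun y z => if s z = 0 then y z else π (y z)
  have hτ : Function.Involutive τ := by
    intro y
    funext z
    simp only [τ]
    split_ifs <;> simp [hπ]
  have hW : ∀ (c : Cube m → ZMod 2) y, W.wordProb (s + c) (τ y) = W.wordProb c y := by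
    intro c y
    refine Finset.prod_congr rfl fun z _ => ?_
    have hx : ∀ x : ZMod 2, x = 0 ∨ x = 1 := by decide
    simp only [τ, Pi.add_apply]
    split_ifs with hs
    · rw [hs, zero_add]
    · rw [(hx (s z)).resolve_left hs]
      rcases hx (c z) with hc | hc
      · rw [hc, add_zero, h, hπ]
      · rw [hc, show (1 : ZMod 2) + 1 = 0 from rfl, h]
  refine ⟨fun y => d (τ y) - s, ?_⟩
  rw [errorProb]
  congr 1
  refine Finset.sum_congr rfl fun c _ => ?_
  rw [← hτ.bijective.sum_comp]
  refine Finset.sum_congr rfl fun y _ => ?_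
  rw [← hW c (τ y), hτ y]
  by_cases hd : d y = s + c <;> simp [hd, sub_eq_iff_eq_add']

/-- Reed-Muller codes can be decoded with error probability at most the sum of the conditional
entropies of the information bits. -/
theorem exists_decoder (m : ℕ) (r : ℤ) :
    ∃ dec, errorProb W (reedMuller m r) dec ≤
      ∑ A : Finset (Fin m) with (A.card : ℤ) ≤ r, H W m A := by
  classical
  set D : Set (Finset (Fin m)) := {A | r < A.card} with hD
  obtain ⟨g, hg⟩ := exists_estimator (law_nonneg W m) (fun ω => ω.1) (observe D)
  have hsum := sum_H_eq_jointEntropy_sub W m D fun A B (hB : r < B.card) hAB =>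
    show r < A.card from hB.trans_le (Nat.cast_le.2 (RMLt.card_le hAB))
  have hfil : (Finset.univ.filter fun A => A ∉ D) =
      Finset.univ.filter fun A : Finset (Fin m) => (A.card : ℤ) ≤ r := by
    ext A; simp [hD]
  rw [condEntropy_observe, ← hsum, hfil] at hg
  set η := ∑ A : Finset (Fin m) with (A.card : ℤ) ≤ r, H W m A with hη
  let Φ : (Cube m → ZMod 2) → Finset (Fin m) → ZMod 2 := Function.surjInv encode_bijective.2
  have hΦ : ∀ u, Φ (encode u) = u := Function.leftInverse_surjInv encode_bijective
  have hΦ' : ∀ x, encode (Φ x) = x := Function.surjInv_eq encode_bijective.2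
  -- This decoder is told the frozen bits of x, so it depends only on the coset of x.
  let d : (Cube m → ZMod 2) → (Cube m → 𝒴) → Cube m → ZMod 2 :=
    fun x y => encode (g (observe D (Φ x, y)))
  have hd : ∀ x, ∀ c ∈ reedMuller m r, d (x + c) = d x := by
    intro x c hc
    obtain ⟨v, rfl, hv⟩ := exists_encode_of_mem_reedMuller hc
    funext y
    have : observe D (Φ (x + encode v), y) = observe D (Φ x, y) := by
      refine observe_eq_iff.2 ⟨rfl, fun B hB => ?_⟩
      have h1 : x + encode v = encode (Φ x + v) := by rw [encode_add, hΦ']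
      simp only [h1, hΦ, Pi.add_apply, hv B hB, add_zero]
    simp only [d, this]
  let e : (Cube m → ZMod 2) → ℝ :=
    fun x => ∑ y, W.wordProb x y * if d x y ≠ x then 1 else 0
  have he : (1 / 2) ^ 2 ^ m * ∑ x, e x ≤ η := by
    refine le_trans (le_of_eq ?_) hg
    rw [← sum_law_mul W m fun x y => if d x y ≠ x then 1 else 0, prob_eq_sum_mul]
    refine Finset.sum_congr rfl fun ω _ => ?_
    simp only [d, hΦ, Set.mem_ofPred_eq, ne_eq, encode_bijective.1.eq_iff]
    congr! 2
  have hC : (0 : ℝ) < Nat.card (reedMuller m r) := Nat.cast_pos.2 Nat.card_pos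
  have havg : ∑ x, (∑ c : reedMuller m r, e (x + c)) / Nat.card (reedMuller m r) ≤
      ∑ _x : Cube m → ZMod 2, η := by
    rw [← Finset.sum_div, Finset.sum_comm, div_le_iff₀ hC]
    have h1 : ∀ c : reedMuller m r, ∑ x, e (x + c) = ∑ x, e x := fun c =>
      Equiv.sum_comp (Equiv.addRight (c : Cube m → ZMod 2)) e
    have h2 : ∑ x, e x ≤ 2 ^ 2 ^ m * η := by
      have := mul_le_mul_of_nonneg_left he (show (0 : ℝ) ≤ 2 ^ 2 ^ m by positivity)
      rwa [← mul_assoc, ← mul_pow, mul_one_div_cancel two_ne_zero, one_pow, one_mul] at this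
    simp only [h1, Finset.sum_const, Finset.card_univ, nsmul_eq_mul, Nat.card_eq_fintype_card,
      Fintype.card_fun, ZMod.card, Fintype.card_fin]
    push_cast
    rw [mul_comm]
    gcongr
  -- Some coset is no worse than the average over cosets; symmetry carries its decoder back to the
  -- code itself.
  obtain ⟨s, -, hs⟩ := Finset.exists_le_of_sum_le Finset.univ_nonempty havg
  obtain ⟨dec, hdec⟩ := exists_decoder_of_coset W (reedMuller m r) s (d s)
  refine ⟨dec, hdec.le.trans (le_trans (le_of_eq ?_) hs)⟩
  congr 1
  refine Finset.sum_congr rfl fun c _ => ?_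
  simp only [e, hd s c c.2]

end Decoding
/-! ### Sizes of layers -/

/-- Induction on the ratio 2(2n + 1)/(n + 1) of consecutive terms, with (2n + 1)(2n + 3) ≤ 4(n +
1)^2. -/
theorem centralBinom_sq_mul_le (n : ℕ) : n.centralBinom ^ 2 * (2 * n + 1) ≤ 16 ^ n := by
  induction n with
  | zero => simp
  | succ n ih =>
    have h := Nat.succ_mul_centralBinom_succ n
    refine le_of_mul_le_mul_left (a := (n + 1) ^ 2) ?_ (pow_pos n.succ_pos 2)
    calc (n + 1) ^ 2 * ((n + 1).centralBinom ^ 2 * (2 * (n + 1) + 1))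
        = ((n + 1) * (n + 1).centralBinom) ^ 2 * (2 * n + 3) := by ring
      _ = n.centralBinom ^ 2 * (2 * n + 1) * (4 * ((2 * n + 1) * (2 * n + 3))) := by rw [h]; ring
      _ ≤ 16 ^ n * (16 * (n + 1) ^ 2) := Nat.mul_le_mul ih (by nlinarith)
      _ = (n + 1) ^ 2 * 16 ^ (n + 1) := by ring

theorem choose_half_sq_mul_le (M : ℕ) : M.choose (M / 2) ^ 2 * M ≤ 4 ^ M := by
  rcases Nat.even_or_odd' M with ⟨n, rfl | rfl⟩
  · have h := centralBinom_sq_mul_le n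
    rw [Nat.centralBinom] at h
    rw [Nat.mul_div_cancel_left n two_pos, pow_mul]
    exact (Nat.mul_le_mul_left _ (Nat.le_succ _)).trans h
  · have h := centralBinom_sq_mul_le (n + 1)
    have h2 : (n + 1).centralBinom = 2 * (2 * n + 1).choose n := by
      rw [Nat.centralBinom, show 2 * (n + 1) = 2 * n + 1 + 1 by ring, Nat.choose_succ_succ,
        Nat.choose_symm_half]
      ring
    rw [h2] at h
    have h3 : (2 * n + 1) / 2 = n := by omega
    rw [h3, pow_succ 4, pow_mul]
    norm_num
    rw [pow_succ 16] at h
    nlinarith [Nat.zero_le ((2 * n + 1).choose n ^ 2)]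

theorem choose_div_two_pow_le {M : ℕ} (hM : 0 < M) (i : ℕ) :
    (M.choose i : ℝ) / 2 ^ M ≤ 1 / √M := by
  have hM' : (0 : ℝ) < M := Nat.cast_pos.2 hM
  have h1 : (M.choose i : ℝ) ≤ M.choose (M / 2) := Nat.cast_le.2 (Nat.choose_le_middle i M)
  have h2 : (M.choose (M / 2) : ℝ) ^ 2 * M ≤ 4 ^ M := by exact_mod_cast choose_half_sq_mul_le M
  rw [div_le_div_iff₀ (by positivity) (Real.sqrt_pos.2 hM'), one_mul]
  refine (mul_le_mul_of_nonneg_right h1 (Real.sqrt_nonneg _)).trans ?_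
  refine abs_le_of_sq_le_sq' ?_ (by positivity) |>.2
  rw [mul_pow, Real.sq_sqrt hM'.le, ← pow_mul, mul_comm M, pow_mul]
  norm_num
  exact h2

theorem card_filter_card_mem_Ico_le (M a d : ℕ) (hM : 0 < M) :
    ((Finset.univ.filter fun A : Finset (Fin M) => A.card ∈ Finset.Ico a (a + d)).card : ℝ) ≤
      2 ^ M * (d / √M) := by
  have h1 : (Finset.univ.filter fun A : Finset (Fin M) => A.card ∈ Finset.Ico a (a + d)) ⊆
      (Finset.Ico a (a + d)).biUnion fun i => Finset.powersetCard i Finset.univ := by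
    intro A hA
    simp only [Finset.mem_filter, Finset.mem_univ, true_and] at hA
    simpa [Finset.mem_powersetCard] using hA
  have h2 := (Finset.card_le_card h1).trans Finset.card_biUnion_le
  simp only [Finset.card_powersetCard, Finset.card_univ, Fintype.card_fin] at h2
  have h3 : ∑ i ∈ Finset.Ico a (a + d), (M.choose i : ℝ) ≤
      ∑ i ∈ Finset.Ico a (a + d), 2 ^ M * (1 / √M) := by
    refine Finset.sum_le_sum fun i _ => ?_
    have := choose_div_two_pow_le hM i
    rwa [div_le_iff₀ (by positivity), mul_comm] at this
  rw [Finset.sum_const, Nat.card_Ico, add_tsub_cancel_left, nsmul_eq_mul] at h3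
  calc _ ≤ ((∑ i ∈ Finset.Ico a (a + d), M.choose i : ℕ) : ℝ) := Nat.cast_le.2 h2
    _ ≤ _ := by
      push_cast
      refine h3.trans (le_of_eq ?_)
      ring

/-! ### From polarization to achieving capacity -/

section Achieve

variable {𝒴 : Type*} [Fintype 𝒴] (W : BMSChannel 𝒴)

theorem sum_H_below_le {M a : ℕ} {c ε : ℝ} (hε : 0 ≤ c * ε)
    (hlow : ∀ A : Finset (Fin M), A.card < a → H W M A ≤ c * ε) :
    ∑ A : Finset (Fin M) with (A.card : ℤ) ≤ a - 1, H W M A ≤ 2 ^ M * (c * ε) := by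
  have h := Finset.sum_le_card_nsmul (Finset.univ.filter fun A : Finset (Fin M) =>
    (A.card : ℤ) ≤ a - 1) (H W M) (c * ε) fun A hA => hlow A (by
      have := (Finset.mem_filter.1 hA).2
      omega)
  refine h.trans ?_
  rw [nsmul_eq_mul]
  gcongr
  have := Finset.card_le_univ (Finset.univ.filter fun A : Finset (Fin M) => (A.card : ℤ) ≤ a - 1)
  rw [Fintype.card_finset, Fintype.card_fin] at this
  exact_mod_cast this

/-- Nearly all of the total 2^M (1 - C) lies on sets of size at least a, each contributing at most
1, so there are nearly 2^M (1 - C) such sets. -/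
theorem rate_le_of_low {M a : ℕ} {c ε : ℝ} (hε : 0 ≤ c * ε)
    (hlow : ∀ A : Finset (Fin M), A.card < a → H W M A ≤ c * ε) :
    rate (reedMuller M (a - 1)) ≤ W.capacity + c * ε := by
  have h1 := sum_H W M
  rw [← Finset.sum_filter_add_sum_filter_not Finset.univ fun A : Finset (Fin M) =>
    (A.card : ℤ) ≤ a - 1] at h1
  have h2 := sum_H_below_le W hε hlow
  have h3 := Finset.sum_le_card_nsmul (Finset.univ.filter fun A : Finset (Fin M) =>
    ¬(A.card : ℤ) ≤ a - 1) (H W M) 1 fun A _ => H_le_one W A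
  have h4 := Finset.card_filter_add_card_filter_not (s := Finset.univ)
    fun A : Finset (Fin M) => (A.card : ℤ) ≤ a - 1
  rw [Finset.card_univ, Fintype.card_finset, Fintype.card_fin] at h4
  have h5 : ((Finset.univ.filter fun A : Finset (Fin M) => (A.card : ℤ) ≤ a - 1).card : ℝ) +
      (Finset.univ.filter fun A : Finset (Fin M) => ¬(A.card : ℤ) ≤ a - 1).card = 2 ^ M := by
    exact_mod_cast h4
  rw [rate_reedMuller, div_le_iff₀ (by positivity)]
  rw [nsmul_eq_mul, mul_one] at h3
  linarith

/-- Sets of size at least a + d each carry almost one bit, so they number little more than 2^M (1 -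
C); the d layers in between are paid for by d/√M. -/
theorem le_rate_of_high {M a d : ℕ} {ε : ℝ} (hM : 0 < M) (hε : 0 ≤ ε)
    (hhigh : ∀ A : Finset (Fin M), a + d ≤ A.card → 1 - ε ≤ H W M A) :
    W.capacity - ε - d / √M ≤ rate (reedMuller M (a - 1)) := by
  set S₁ := Finset.univ.filter fun A : Finset (Fin M) => (A.card : ℤ) ≤ a - 1 with hS₁
  set S₂ := Finset.univ.filter fun A : Finset (Fin M) => A.card ∈ Finset.Ico a (a + d) with hS₂
  set S₃ := Finset.univ.filter fun A : Finset (Fin M) => a + d ≤ A.card with hS₃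
  have h1 : ∑ A ∈ S₃, H W M A ≤ 2 ^ M * (1 - W.capacity) := by
    rw [← sum_H]
    exact Finset.sum_le_univ_sum_of_nonneg fun A => H_nonneg W A
  have h2 := Finset.card_nsmul_le_sum S₃ (H W M) (1 - ε) fun A hA =>
    hhigh A (Finset.mem_filter.1 hA).2
  have h3 : (S₂.card : ℝ) ≤ 2 ^ M * (d / √M) := card_filter_card_mem_Ico_le M a d hM
  have h4 : (2 : ℝ) ^ M ≤ S₁.card + S₂.card + S₃.card := by
    have hsub : (Finset.univ : Finset (Finset (Fin M))) ⊆ S₁ ∪ S₂ ∪ S₃ := by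
      intro A _
      simp only [hS₁, hS₂, hS₃, Finset.mem_union, Finset.mem_filter, Finset.mem_univ, true_and,
        Finset.mem_Ico]
      omega
    have h := (Finset.card_le_card hsub).trans (Finset.card_union_le _ _)
    have h' := h.trans (Nat.add_le_add_right (Finset.card_union_le _ _) _)
    rw [Finset.card_univ, Fintype.card_finset, Fintype.card_fin] at h'
    exact_mod_cast h'
  have h5 : (S₃.card : ℝ) ≤ 2 ^ M := by
    have := Finset.card_le_univ S₃
    rw [Fintype.card_finset, Fintype.card_fin] at this
    exact_mod_cast this
  rw [rate_reedMuller, le_div_iff₀ (by positivity)]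
  rw [nsmul_eq_mul] at h2
  have h6 := mul_le_mul_of_nonneg_right h5 hε
  linarith

/-! ### Asymptotics of the number of steps -/

/-- The number of steps by which a layer is polarized to length `2 ^ M`. -/
def steps (M : ℕ) : ℕ := 2 * (Nat.log 2 M + 1)

theorem sq_le_two_pow_steps (M : ℕ) : M ^ 2 ≤ 2 ^ steps M := by
  rw [steps, mul_comm, pow_mul]
  exact Nat.pow_le_pow_left (Nat.lt_pow_succ_log_self one_lt_two M).le 2

theorem tendsto_sqrt_natCast : Tendsto (fun M : ℕ => √(M : ℝ)) atTop atTop :=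
  Real.tendsto_sqrt_atTop.comp tendsto_natCast_atTop_atTop

theorem one_isLittleO_sqrt : (fun _ : ℕ => (1 : ℝ)) =o[atTop] fun M : ℕ => √(M : ℝ) :=
  isLittleO_const_left.2 (Or.inr (tendsto_norm_atTop_atTop.comp tendsto_sqrt_natCast))

theorem steps_isLittleO : (fun M : ℕ => (steps M : ℝ)) =o[atTop] fun M : ℕ => √(M : ℝ) := by
  have h1 : (fun M : ℕ => Real.log (M : ℝ)) =o[atTop] fun M : ℕ => √(M : ℝ) := by
    simp only [Real.sqrt_eq_rpow]
    exact (isLittleO_log_rpow_atTop (by norm_num : (0 : ℝ) < 1 / 2)).comp_tendsto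
      tendsto_natCast_atTop_atTop
  have h3 : (fun M : ℕ => 2 * (Real.log M / Real.log 2 + 1)) =o[atTop] fun M : ℕ => √(M : ℝ) := by
    simp only [div_eq_inv_mul]
    exact ((h1.const_mul_left _).add one_isLittleO_sqrt).const_mul_left 2
  refine IsBigO.trans_isLittleO (IsBigO.of_bound' (Eventually.of_forall fun M => ?_)) h3
  have h4 : (Nat.log 2 M : ℝ) ≤ Real.log M / Real.log 2 := by
    simpa [Real.logb] using Real.natLog_le_logb M 2
  rw [Real.norm_of_nonneg (Nat.cast_nonneg _)]
  refine le_trans ?_ (Real.le_norm_self _)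
  rw [steps]
  push_cast
  linarith

theorem tendsto_two_pow_mul_pow_steps {z : ℝ} (h0 : 0 ≤ z) (h1 : z < 1) :
    Tendsto (fun M : ℕ => (2 : ℝ) ^ M * z ^ 2 ^ steps M) atTop (𝓝 0) := by
  have h2 : ∀ᶠ M : ℕ in atTop, z ^ M ≤ 1 / 4 :=
    (tendsto_pow_atTop_nhds_zero_of_lt_one h0 h1).eventually_le_const (by norm_num)
  refine tendsto_of_tendsto_of_tendsto_of_le_of_le' tendsto_const_nhds
    (tendsto_pow_atTop_nhds_zero_of_lt_one (by norm_num : (0 : ℝ) ≤ 1 / 2) (by norm_num))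
    (Eventually.of_forall fun M => by positivity) ?_
  filter_upwards [h2] with M hM
  calc (2 : ℝ) ^ M * z ^ 2 ^ steps M ≤ 2 ^ M * z ^ M ^ 2 := by
        gcongr 2 ^ M * ?_
        exact pow_le_pow_of_le_one h0 h1.le (sq_le_two_pow_steps M)
    -- The exponent M^2 is what lets the decay absorb the 2^M sets.
    _ = (2 * z ^ M) ^ M := by rw [mul_pow, ← pow_mul, sq]
    _ ≤ (1 / 2) ^ M := by gcongr; linarith

theorem eventually_steps_le_half : ∀ᶠ M : ℕ in atTop, 2 * steps M ≤ M := by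
  filter_upwards [steps_isLittleO.bound (by norm_num : (0 : ℝ) < 1 / 2), eventually_ge_atTop 1]
    with M hM hM1
  have h1 : √(M : ℝ) ≤ M := by
    rw [Real.sqrt_le_left (Nat.cast_nonneg _)]
    have : (1 : ℝ) ≤ M := by exact_mod_cast hM1
    nlinarith
  rw [Real.norm_of_nonneg (Nat.cast_nonneg _), Real.norm_of_nonneg (Real.sqrt_nonneg _)] at hM
  have : (2 * steps M : ℝ) ≤ M := by linarith
  exact_mod_cast this

theorem tendsto_sub_steps : Tendsto (fun M => M - steps M) atTop atTop := by
  refine tendsto_atTop_mono' atTop ?_ (Nat.tendsto_div_const_atTop two_ne_zero)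
  filter_upwards [eventually_steps_le_half] with M hM
  omega

/-- The value m + 1 is the default when no layer exceeds t. -/
theorem exists_threshold (m : ℕ) (t : ℝ) :
    ∃ a ≤ m + 1, (∀ i < a, Hmax W m i ≤ t) ∧ (a ≤ m → t < Hmax W m a) := by
  classical
  have h : ∃ i, m < i ∨ t < Hmax W m i := ⟨m + 1, Or.inl m.lt_succ_self⟩
  refine ⟨Nat.find h, Nat.find_min' h (Or.inl m.lt_succ_self), fun i hi => ?_, fun ha => ?_⟩
  · exact not_lt.1 fun h' => Nat.find_min h hi (Or.inr h')
  · exact (Nat.find_spec h).resolve_left ha.not_gt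

theorem rmAchievesCapacity_of_gap {γ : ℝ} (hγ : γ < 1) {Δ : ℕ → ℕ}
    (hΔ : (fun m : ℕ => (Δ m : ℝ)) =o[atTop] fun m : ℕ => √(m : ℝ))
    (h : ∀ m i : ℕ, 0 < m → i + Δ m ≤ m → Hmax W m i ≤ Hmin W m (i + Δ m) + γ) :
    RMAchievesCapacity W := by
  wlog hγ0 : 0 ≤ γ generalizing γ
  · exact this zero_lt_one (fun m i hm hi => (h m i hm hi).trans (by linarith)) le_rfl
  have hl := Real.log_pos one_lt_two
  -- The midpoint of γ and 1 makes the two margins 1 - t and t - γ both equal to s.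
  set t := (1 + γ) / 2 with ht
  set s := (1 - γ) / 2 with hs
  have hs0 : 0 < s := by linarith
  set z := max √(1 - (1 - t) ^ 2) √(1 - (s * Real.log 2 / 2) ^ 2) with hz
  have hz0 : 0 ≤ z := le_max_of_le_left (Real.sqrt_nonneg _)
  have hz1 : z < 1 := by
    rw [hz, max_lt_iff, Real.sqrt_lt' one_pos, Real.sqrt_lt' one_pos]
    have h1 : 0 < (1 - t) ^ 2 := by
      have : 0 < 1 - t := by linarith
      positivity
    have h2 : 0 < (s * Real.log 2 / 2) ^ 2 := by positivity
    constructor <;> linarith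
  choose a ha hlow hhigh using fun m => exists_threshold W m t
  set c := 2 / Real.log 2 with hc
  have hc0 : 0 < c := by positivity
  set ε : ℕ → ℝ := fun M => z ^ 2 ^ steps M with hε
  have hε0 : ∀ M, 0 ≤ ε M := fun M => by positivity
  have hcε0 : ∀ M, 0 ≤ c * ε M := fun M => mul_nonneg hc0.le (hε0 M)
  have hlow' : ∀ M m, M = m + steps M → ∀ A : Finset (Fin M), A.card < a m →
      H W M A ≤ c * ε M := by
    intro M m hM A hA
    have h1 := (rmBhatt_le_of_H_le W (by linarith) (hlow m _ hA)).trans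
      (le_max_left _ _ : _ ≤ z)
    exact H_le_of_rmBhatt_le W hM (by have := ha m; omega) h1
  have hhigh' : ∀ M m, 0 < m → M = m + steps M → ∀ A : Finset (Fin M),
      a m + (Δ m + steps M) ≤ A.card → 1 - ε M ≤ H W M A := by
    intro M m hm hM A hA
    have hAM : A.card ≤ M := by simpa using A.card_le_univ
    -- The existence of a set A this large forces a + Δ ≤ m, so the threshold is genuine and the gap
    -- hypothesis applies.
    have h1 := hhigh m (by omega)
    have h2 := h m (a m) hm (by omega)
    have h3 := (rmBias_le_of_le_H W hs0.le (show s ≤ Hmin W m (a m + Δ m) by linarith)).trans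
      (le_max_right _ _ : _ ≤ z)
    exact one_sub_le_H_of_rmBias_le W hM (by omega) h3
  choose dec hdec using fun M => exists_decoder W M ((a (M - steps M) : ℤ) - 1)
  have hev : ∀ᶠ M in atTop, 0 < M - steps M ∧ M = M - steps M + steps M := by
    filter_upwards [eventually_steps_le_half, eventually_gt_atTop 0] with M hM hM0
    omega
  have herr : Tendsto (fun M : ℕ => 2 ^ M * (c * ε M)) atTop (𝓝 0) := by
    have := (tendsto_two_pow_mul_pow_steps hz0 hz1).const_mul c
    rw [mul_zero] at this
    exact this.congr fun M => mul_left_comm _ _ _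
  have hε' : Tendsto ε atTop (𝓝 0) := by
    refine squeeze_zero hε0 (fun M => ?_) (tendsto_two_pow_mul_pow_steps hz0 hz1)
    exact le_mul_of_one_le_left (hε0 M) (one_le_pow₀ one_le_two)
  have hmid : Tendsto (fun M : ℕ => ((Δ (M - steps M) + steps M : ℕ) : ℝ) / √M) atTop (𝓝 0) := by
    have h1 : (fun M => (Δ (M - steps M) : ℝ)) =o[atTop] fun M : ℕ => √(M : ℝ) := by
      refine (hΔ.comp_tendsto tendsto_sub_steps).trans_isBigO
        (IsBigO.of_bound' (Eventually.of_forall fun M => ?_))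
      rw [Function.comp_apply, Real.norm_of_nonneg (Real.sqrt_nonneg _),
        Real.norm_of_nonneg (Real.sqrt_nonneg _)]
      exact Real.sqrt_le_sqrt (Nat.cast_le.2 (Nat.sub_le _ _))
    have h2 := (h1.add steps_isLittleO).tendsto_div_nhds_zero
    exact_mod_cast h2
  -- The order in dimension M comes from the threshold `steps M` dimensions lower; threshold 0 gives
  -- the zero code.
  refine ⟨fun M => (a (M - steps M) : ℤ) - 1, fun M => ?_, dec, ?_, ?_⟩
  · have := ha (M - steps M)
    dsimp only
    constructor <;> omega
  · have hlim1 : Tendsto (fun M : ℕ => W.capacity - ε M -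
        ((Δ (M - steps M) + steps M : ℕ) : ℝ) / √M) atTop (𝓝 W.capacity) := by
      simpa using (hε'.const_sub W.capacity).sub hmid
    have hlim2 : Tendsto (fun M : ℕ => W.capacity + c * ε M) atTop (𝓝 W.capacity) := by
      simpa using (hε'.const_mul c).const_add W.capacity
    refine tendsto_of_tendsto_of_tendsto_of_le_of_le' hlim1 hlim2 ?_ ?_
    · filter_upwards [hev] with M hM
      exact le_rate_of_high W (by omega) (hε0 M) (hhigh' M _ hM.1 hM.2)
    · filter_upwards [hev] with M hM
      exact rate_le_of_low W (hcε0 M) (hlow' M _ hM.2)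
  · refine tendsto_of_tendsto_of_tendsto_of_le_of_le' tendsto_const_nhds herr
      (Eventually.of_forall fun M => errorProb_nonneg W _ _) ?_
    filter_upwards [hev] with M hM
    exact (hdec M).trans (sum_H_below_le W (hcε0 M) (hlow' M _ hM.2))

end Achieve

end RMPolar

theorem mainTheorem8 {𝒴 : Type*} [Fintype 𝒴] (W : RMPolar.BMSChannel 𝒴) :
    ((∃ γ : ℝ, γ < 1 ∧ ∃ Δ : ℕ → ℕ,
        (fun m : ℕ => (Δ m : ℝ)) =o[atTop] (fun m : ℕ => √(m : ℝ)) ∧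
        ∀ m i : ℕ, 0 < m → i + Δ m ≤ m →
          RMPolar.Hmax W m i ≤ RMPolar.Hmin W m (i + Δ m) + γ) →
      RMPolar.RMAchievesCapacity W) ∧
    ((∀ m i : ℕ, 0 < m → i + 1 ≤ m → RMPolar.Hmax W m i ≤ RMPolar.Hmin W m (i + 1)) →
      RMPolar.RMAchievesCapacity W) := by
  refine ⟨fun ⟨γ, hγ, Δ, hΔ, h⟩ => RMPolar.rmAchievesCapacity_of_gap W hγ hΔ h, fun h => ?_⟩
  refine RMPolar.rmAchievesCapacity_of_gap W zero_lt_one (Δ := fun _ => 1) ?_ fun m i hm hi => ?_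
  · simpa using RMPolar.one_isLittleO_sqrt
  · simpa using h m i hm hi
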